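/- **Conventions.** $\mathrm{Hilb}$ is the category of complex Hilbert spaces and bounded linear maps, with the completed tensor product $\otimes$; $(-)^\dagger$ is the adjoint, and limits and continuity of operators refer to the strong operator topology. A *regularised Frobenius algebra* (RFA) is a Hilbert space $A$ with bounded maps $\mu_a:A\otimes A\to A$, $\eta_a:\mathbb C\to A$, $\Delta_a:A\to A\otimes A$, $\varepsilon_a:A\to\mathbb C$ for all $a>0$ such that, whenever $a_1+a_2=b_1+b_2=c_1+c_2=a$ with all parameters positive, - $\mu_{a_1}(\mathrm{id}\otimes\eta_{a_2})=\mu_{b_1}(\eta_{b_2}\otimes\mathrm{id})=:P_a$ and $\mu_{a_1}(\mathrm{id}\otimes\mu_{a_2})=\mu_{b_1}(\mu_{b_2}\otimes\mathrm{id})$; - $(\mathrm{id}\otimes\varepsilon_{a_2})\Delta_{a_1}=(\varepsilon_{b_2}\otimes\mathrm{id})\Delta_{b_1}=:P'_a$ and $(\mathrm{id}\otimes\Delta_{a_2})\Delta_{a_1}=(\Delta_{b_2}\otimes\mathrm{id})\Delta_{b_1}$; - $(\mathrm{id}\otimes\mu_{a_1})(\Delta_{a_2}\otimes\mathrm{id})=\Delta_{c_1}\mu_{c_2}=(\mu_{b_1}\otimes\mathrm{id})(\mathrm{id}\otimes\Delta_{b_2})$;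 - $\lim_{a\to0}P_a=\mathrm{id}_A$, and with $P_0=\mathrm{id}_A$ the maps $(a_1,\dots,a_n)\mapsto P_{a_1}\otimes\dots\otimes P_{a_n}$ on $\mathbb R_{\ge0}^n$ are jointly continuous for all $n\ge1$; likewise for $P'$. A morphism of RFAs is a bounded linear map compatible with $\mu_a,\eta_a,\Delta_a,\varepsilon_a$ for all $a>0$. An RFA is *Hermitian* if $\mu_a^\dagger=\Delta_a$ and $\eta_a^\dagger=\varepsilon_a$ for all $a>0$; the Hermitian RFAs form a full subcategory of the category of RFAs. A *$\dagger$-Frobenius algebra* is a Frobenius algebra $(F,\mu,\eta,\Delta,\varepsilon)$ in $\mathrm{Hilb}$ with $\mu^\dagger=\Delta$ and $\eta^\dagger=\varepsilon$. For $\sigma\in\mathbb R$, it is a Hermitian RFA with structure maps $e^{-a\sigma}\mu$, $e^{-a\sigma}\eta$, $e^{-a\sigma}\Delta$, $e^{-a\sigma}\varepsilon$, and then $P_a=e^{-a\sigma}\mathrm{id}_F$. Let $\mathcal F$ be the category whose objects are the countable families $\Phi=\{F_j,\sigma_j\}_{j\in I}$ of $\dagger$-Frobenius algebras $F_j$ and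 real numbers $\sigma_j$ such that for all $a>0$ $$\sup_{j\in I}e^{-a\sigma_j}\|\mu_j\|<\infty\qquad\text{and}\qquad\sum_{j\in I}e^{-2a\sigma_j}\|\eta_j\|^2<\infty .$$ A morphism $\{F_j,\sigma_j\}_{j\in I}\to\{F'_k,\sigma'_k\}_{k\in I'}$ is a bijection $f:I\to I'$ with $\sigma_j=\sigma'_{f(j)}$ together with morphisms of Frobenius algebras (bounded linear maps compatible with $\mu,\eta,\Delta,\varepsilon$) $\psi_j:F_j\to F'_{f(j)}$ such that $\sup_{j}\|\psi_j\|<\infty$. Call $\Phi$ *reduced* if all $F_j\neq0$ and the $\sigma_j$ are pairwise distinct. **Theorem.** 1. There is a functor $\Phi\mapsto\bigoplus_{j\in I}F_j$ from $\mathcal F$ to the category of Hermitian RFAs. It sends $\Phi$ to the Hilbert direct sum of the $F_j$, where $F_j$ carries the RFA structure with $P_a=e^{-a\sigma_j}\mathrm{id}$ and the structure maps of the sum are the sums of those of the summands; it sends $(f,\{\psi_j\})$ to $\bigoplus_j\psi_j$. Its restriction to the full subcategory of reduced families is an equivalence of categories onto the category of Hermitian RFAs. 2. In particular, every Hermitian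 RFA is a Hilbert direct sum of finite-dimensional Hermitian RFAs; more precisely, it is the (orthogonal, isometric) Hilbert direct sum of some reduced family in $\mathcal F$ all of whose members $F_j$ are finite-dimensional. -/

import Mathlib

open scoped TensorProduct NNReal Topology
open CategoryTheory

universe u v

noncomputable section

namespace HermRFA

/-! ### The tensor product of Hilbert spaces -/

section Tensor

/-- The Hilbert space tensor product: the completion of the algebraic tensor product with respect
to the inner product `⟪x ⊗ y, x' ⊗ y'⟫ = ⟪x, x'⟫ * ⟪y, y'⟫`. -/
abbrev HTensor (E : Type u) (F : Type v) [NormedAddCommGroup E] [InnerProductSpace ℂ E]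
    [NormedAddCommGroup F] [InnerProductSpace ℂ F] : Type (max u v) :=
  UniformSpace.Completion (E ⊗[ℂ] F)

variable {E E' E'' F F' F'' G : Type*}
  [NormedAddCommGroup E] [InnerProductSpace ℂ E] [NormedAddCommGroup F] [InnerProductSpace ℂ F]
  [NormedAddCommGroup G] [InnerProductSpace ℂ G]
  [NormedAddCommGroup E'] [InnerProductSpace ℂ E'] [NormedAddCommGroup F'] [InnerProductSpace ℂ F']
  [NormedAddCommGroup E''] [InnerProductSpace ℂ E'']
  [NormedAddCommGroup F''] [InnerProductSpace ℂ F'']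

/-- The elementary tensor `x ⊗ y` in the Hilbert space tensor product. -/
def tmul (x : E) (y : F) : HTensor E F := ((x ⊗ₜ[ℂ] y : E ⊗[ℂ] F) : HTensor E F)

/-- The tensor product `f ⊗ g` of bounded linear maps. -/
def tmap (f : E →L[ℂ] E') (g : F →L[ℂ] F') : HTensor E F →L[ℂ] HTensor E' F' :=
  (TensorProduct.mapL f g).completion

theorem tmap_tmul (f : E →L[ℂ] E') (g : F →L[ℂ] F') (x : E) (y : F) :
    tmap f g (tmul x y) = tmul (f x) (g y) := by
  simp [tmap, tmul]

/-- Bounded linear maps out of a tensor product are determined by their values on elementary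
tensors. -/
theorem ext_tmul {f g : HTensor E F →L[ℂ] G} (h : ∀ x y, f (tmul x y) = g (tmul x y)) :
    f = g := by
  refine ContinuousLinearMap.ext fun z => ?_
  induction z using UniformSpace.Completion.induction_on with
  | hp => exact isClosed_eq f.continuous g.continuous
  | ih t =>
    induction t using TensorProduct.induction_on with
    | zero => rw [UniformSpace.Completion.coe_zero, map_zero, map_zero]
    | tmul x y => exact h x y
    | add a b ha hb => simp [UniformSpace.Completion.coe_add, ha, hb]

theorem tmap_id : tmap (.id ℂ E) (.id ℂ F) = .id ℂ (HTensor E F) :=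
  ext_tmul fun x y => by simp [tmap_tmul]

theorem tmap_comp (f' : E' →L[ℂ] E'') (f : E →L[ℂ] E') (g' : F' →L[ℂ] F'') (g : F →L[ℂ] F') :
    tmap (f' ∘L f) (g' ∘L g) = tmap f' g' ∘L tmap f g :=
  ext_tmul fun x y => by simp [tmap_tmul]

theorem tmul_smul_left (c : ℂ) (x : E) (y : F) : tmul (c • x) y = c • tmul x y := by
  simp [tmul, ← UniformSpace.Completion.coe_smul, TensorProduct.smul_tmul']

theorem tmul_smul_right (c : ℂ) (x : E) (y : F) : tmul x (c • y) = c • tmul x y := by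
  simp [tmul, ← UniformSpace.Completion.coe_smul, TensorProduct.tmul_smul]

theorem tmap_smul_left (c : ℂ) (f : E →L[ℂ] E') (g : F →L[ℂ] F') :
    tmap (c • f) g = c • tmap f g :=
  ext_tmul fun x y => by simp [tmap_tmul, tmul_smul_left]

theorem tmap_smul_right (c : ℂ) (f : E →L[ℂ] E') (g : F →L[ℂ] F') :
    tmap f (c • g) = c • tmap f g :=
  ext_tmul fun x y => by simp [tmap_tmul, tmul_smul_right]


/-- The unit isomorphism `ℂ ⊗ E ≅ E`, with `c ⊗ x ↦ c • x`. -/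
def lunit [CompleteSpace E] : HTensor ℂ E →L[ℂ] E :=
  ((TensorProduct.lidIsometry ℂ E).toLinearIsometry.toContinuousLinearMap).fromCompletion

/-- The unit isomorphism `E ⊗ ℂ ≅ E`, with `x ⊗ c ↦ c • x`. -/
def runit [CompleteSpace E] : HTensor E ℂ →L[ℂ] E :=
  ((TensorProduct.ridIsometry ℂ E).toLinearIsometry.toContinuousLinearMap).fromCompletion

/-- The inverse of the unit isomorphism `ℂ ⊗ E ≅ E`, namely `x ↦ 1 ⊗ x`. -/
def lunitInv : E →L[ℂ] HTensor ℂ E :=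
  UniformSpace.Completion.toComplL ∘L TensorProduct.mkL ℂ ℂ E 1

/-- The inverse of the unit isomorphism `E ⊗ ℂ ≅ E`, namely `x ↦ x ⊗ 1`. -/
def runitInv : E →L[ℂ] HTensor E ℂ :=
  UniformSpace.Completion.toComplL ∘L (TensorProduct.mkL ℂ E ℂ).flip 1

theorem lunit_tmul [CompleteSpace E] (c : ℂ) (x : E) : lunit (tmul c x) = c • x := by
  simp [lunit, tmul]

theorem runit_tmul [CompleteSpace E] (x : E) (c : ℂ) : runit (tmul x c) = c • x := by
  simp [runit, tmul]

theorem lunitInv_apply (x : E) : lunitInv x = tmul 1 x := rfl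

theorem runitInv_apply (x : E) : runitInv x = tmul x 1 := rfl

/-- The canonical map `(E ⊗ F) ⊗ G → (E ⊗ₕ F) ⊗ₕ G` from the algebraic triple tensor product. -/
def algToLeft : (E ⊗[ℂ] F) ⊗[ℂ] G →L[ℂ] HTensor (HTensor E F) G :=
  UniformSpace.Completion.toComplL ∘L
    TensorProduct.mapL UniformSpace.Completion.toComplL (.id ℂ G)

/-- The canonical map `E ⊗ (F ⊗ G) → E ⊗ₕ (F ⊗ₕ G)` from the algebraic triple tensor product. -/
def algToRight : E ⊗[ℂ] (F ⊗[ℂ] G) →L[ℂ] HTensor E (HTensor F G) :=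
  UniformSpace.Completion.toComplL ∘L
    TensorProduct.mapL (.id ℂ E) UniformSpace.Completion.toComplL

theorem algToLeft_tmul (x : E) (y : F) (z : G) :
    algToLeft ((x ⊗ₜ y) ⊗ₜ z) = tmul (tmul x y) z := rfl

theorem algToRight_tmul (x : E) (y : F) (z : G) :
    algToRight (x ⊗ₜ (y ⊗ₜ z)) = tmul x (tmul y z) := rfl

theorem norm_algToLeft (t : (E ⊗[ℂ] F) ⊗[ℂ] G) : ‖algToLeft t‖ = ‖t‖ := by
  have h := (TensorProduct.mapIsometry
    (UniformSpace.Completion.toComplₗᵢ : (E ⊗[ℂ] F) →ₗᵢ[ℂ] HTensor E F)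
    (LinearIsometry.id : G →ₗᵢ[ℂ] G)).norm_map t
  rw [TensorProduct.mapIsometry_apply] at h
  rw [← h]
  simp only [algToLeft, ContinuousLinearMap.comp_apply, UniformSpace.Completion.coe_toComplL,
    UniformSpace.Completion.norm_coe, TensorProduct.mapL_apply]
  rfl

theorem norm_algToRight (t : E ⊗[ℂ] (F ⊗[ℂ] G)) : ‖algToRight t‖ = ‖t‖ := by
  have h := (TensorProduct.mapIsometry (LinearIsometry.id : E →ₗᵢ[ℂ] E)
    (UniformSpace.Completion.toComplₗᵢ : (F ⊗[ℂ] G) →ₗᵢ[ℂ] HTensor F G)).norm_map t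
  rw [TensorProduct.mapIsometry_apply] at h
  rw [← h]
  simp only [algToRight, ContinuousLinearMap.comp_apply, UniformSpace.Completion.coe_toComplL,
    UniformSpace.Completion.norm_coe, TensorProduct.mapL_apply]
  rfl

theorem tmul_mem_of_forall {S : Submodule ℂ (HTensor E F)} (hS : IsClosed (S : Set (HTensor E F)))
    (h : ∀ x y, tmul x y ∈ S) (z : HTensor E F) : z ∈ S := by
  induction z using UniformSpace.Completion.induction_on with
  | hp => exact hS
  | ih t =>
    induction t using TensorProduct.induction_on with
    | zero => rw [UniformSpace.Completion.coe_zero]; exact S.zero_mem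
    | tmul x y => exact h x y
    | add a b ha hb => simpa [UniformSpace.Completion.coe_add] using S.add_mem ha hb

theorem continuous_tmul_left (y : F) : Continuous fun x : E => tmul x y :=
  (UniformSpace.Completion.toComplL ∘L (TensorProduct.mkL ℂ E F).flip y).continuous

theorem continuous_tmul_right (x : E) : Continuous fun y : F => tmul x y :=
  (UniformSpace.Completion.toComplL ∘L TensorProduct.mkL ℂ E F x).continuous

theorem tmul_add_left (x x' : E) (y : F) : tmul (x + x') y = tmul x y + tmul x' y :=
  (UniformSpace.Completion.toComplL ∘L (TensorProduct.mkL ℂ E F).flip y).map_add x x'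

theorem tmul_add_right (x : E) (y y' : F) : tmul x (y + y') = tmul x y + tmul x y' :=
  (UniformSpace.Completion.toComplL ∘L TensorProduct.mkL ℂ E F x).map_add y y'

theorem denseRange_algToLeft :
    DenseRange (algToLeft : (E ⊗[ℂ] F) ⊗[ℂ] G →L[ℂ] HTensor (HTensor E F) G) := by
  set L : (E ⊗[ℂ] F) ⊗[ℂ] G →L[ℂ] HTensor (HTensor E F) G := algToLeft
  intro w
  have key : w ∈ L.toLinearMap.range.topologicalClosure := by
    refine tmul_mem_of_forall (Submodule.isClosed_topologicalClosure _) (fun s z => ?_) w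
    induction s using UniformSpace.Completion.induction_on with
    | hp =>
      exact (Submodule.isClosed_topologicalClosure _).preimage (continuous_tmul_left z)
    | ih t => exact Submodule.le_topologicalClosure _ ⟨t ⊗ₜ z, rfl⟩
  exact key

theorem denseRange_algToRight :
    DenseRange (algToRight : E ⊗[ℂ] (F ⊗[ℂ] G) →L[ℂ] HTensor E (HTensor F G)) := by
  set L : E ⊗[ℂ] (F ⊗[ℂ] G) →L[ℂ] HTensor E (HTensor F G) := algToRight
  intro w
  have key : w ∈ L.toLinearMap.range.topologicalClosure := by
    refine tmul_mem_of_forall (Submodule.isClosed_topologicalClosure _) (fun x s => ?_) w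
    induction s using UniformSpace.Completion.induction_on with
    | hp =>
      exact (Submodule.isClosed_topologicalClosure _).preimage (continuous_tmul_right x)
    | ih t => exact Submodule.le_topologicalClosure _ ⟨x ⊗ₜ t, rfl⟩
  exact key

/-- The associativity isomorphism `(E ⊗ F) ⊗ G ≅ E ⊗ (F ⊗ G)`, with
`(x ⊗ y) ⊗ z ↦ x ⊗ (y ⊗ z)`. -/
def assoc : HTensor (HTensor E F) G →L[ℂ] HTensor E (HTensor F G) :=
  (algToRight ∘L (TensorProduct.assocIsometry ℂ E F G).toLinearIsometry.toContinuousLinearMap).extend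
    algToLeft

/-- The inverse associativity isomorphism `E ⊗ (F ⊗ G) ≅ (E ⊗ F) ⊗ G`, with
`x ⊗ (y ⊗ z) ↦ (x ⊗ y) ⊗ z`. -/
def assocInv : HTensor E (HTensor F G) →L[ℂ] HTensor (HTensor E F) G :=
  (algToLeft ∘L
    (TensorProduct.assocIsometry ℂ E F G).symm.toLinearIsometry.toContinuousLinearMap).extend
    algToRight

theorem assoc_tmul (x : E) (y : F) (z : G) :
    assoc (tmul (tmul x y) z) = tmul x (tmul y z) := by
  have h := (algToRight ∘L
    (TensorProduct.assocIsometry ℂ E F G).toLinearIsometry.toContinuousLinearMap).extend_eq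
    (e := algToLeft) denseRange_algToLeft
    (AddMonoidHomClass.isometry_of_norm _ norm_algToLeft).isUniformInducing ((x ⊗ₜ y) ⊗ₜ z)
  exact h

theorem assocInv_tmul (x : E) (y : F) (z : G) :
    assocInv (tmul x (tmul y z)) = tmul (tmul x y) z := by
  have h := (algToLeft ∘L
    (TensorProduct.assocIsometry ℂ E F G).symm.toLinearIsometry.toContinuousLinearMap).extend_eq
    (e := algToRight) denseRange_algToRight
    (AddMonoidHomClass.isometry_of_norm _ norm_algToRight).isUniformInducing (x ⊗ₜ (y ⊗ₜ z))
  exact h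

end Tensor

/-! ### Hilbert spaces and tensor powers of operators -/

/-- A complex Hilbert space, as an object of the category of Hilbert spaces and bounded linear
maps. -/
structure HilbSp : Type (u + 1) where
  /-- The underlying set of vectors. -/
  carrier : Type u
  [normed : NormedAddCommGroup carrier]
  [inner : InnerProductSpace ℂ carrier]
  [complete : CompleteSpace carrier]

instance : CoeSort HilbSp.{u} (Type u) := ⟨HilbSp.carrier⟩

attribute [instance] HilbSp.normed HilbSp.inner HilbSp.complete

/-- The tensor power `A ^ ⊗ (n + 1)`, i.e. `A ⊗ (A ⊗ (⋯ ⊗ A))` with `n + 1` factors. -/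
def tpow (A : HilbSp.{u}) : ℕ → HilbSp.{u}
  | 0 => A
  | n + 1 => ⟨HTensor A (tpow A n)⟩

/-- The operator `f 0 ⊗ f 1 ⊗ ⋯ ⊗ f n` on `A ^ ⊗ (n + 1)`. -/
def tpowMap (A : HilbSp.{u}) : (n : ℕ) → (Fin (n + 1) → A →L[ℂ] A) → (tpow A n →L[ℂ] tpow A n)
  | 0, f => f 0
  | n + 1, f => tmap (f 0) (tpowMap A n fun i => f i.succ)

/-- The set of positive reals, which parametrises the structure maps. -/
abbrev PosReal : Type := {a : ℝ // 0 < a}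

/-- Half of a positive real number. -/
def half (a : PosReal) : PosReal := ⟨a.1 / 2, half_pos a.2⟩

theorem half_add_half (a : PosReal) : half a + half a = a :=
  Subtype.ext (add_halves a.1)

/-- A family `P a`, `a > 0`, extended to `a ≥ 0` by the identity at `a = 0`. -/
def extendZero {A : HilbSp.{u}} (P : PosReal → A →L[ℂ] A) (t : ℝ≥0) : A →L[ℂ] A :=
  if h : 0 < (t : ℝ) then P ⟨t, h⟩ else .id ℂ A

/-- The continuity conditions on the family `P`, in the strong operator topology: `P a → id` as
`a → 0`, and `(a₁, …, aₙ) ↦ P a₁ ⊗ ⋯ ⊗ P aₙ` is jointly continuous on `[0, ∞)ⁿ` for all `n ≥ 1`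
(with `P 0 = id`). -/
structure IsContinuousFamily {A : HilbSp.{u}} (P : PosReal → A →L[ℂ] A) : Prop where
  tendsto_id : ∀ x : A, Filter.Tendsto (fun a : PosReal => P a x)
    (Filter.comap Subtype.val (𝓝 (0 : ℝ))) (𝓝 x)
  jointly_continuous : ∀ (n : ℕ) (z : tpow A n),
    Continuous fun t : Fin (n + 1) → ℝ≥0 => tpowMap A n (fun i => extendZero P (t i)) z

/-! ### Regularised algebras, coalgebras and Frobenius algebras -/

/-- A regularised algebra structure on the Hilbert space `A`. In `continuous_family`, the operator
`P a = μ a₁ ∘ (id ⊗ η a₂)` is computed with `a₁ = a₂ = a / 2`; by `unit` it is the same for all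
`a₁ + a₂ = a`. -/
structure RegAlgebra (A : HilbSp.{u}) where
  /-- The product. -/
  μ : PosReal → (HTensor A A →L[ℂ] A)
  /-- The unit. -/
  η : PosReal → (ℂ →L[ℂ] A)
  unit : ∀ a₁ a₂ b₁ b₂ : PosReal, a₁ + a₂ = b₁ + b₂ →
    μ a₁ ∘L tmap (.id ℂ A) (η a₂) ∘L runitInv = μ b₁ ∘L tmap (η b₂) (.id ℂ A) ∘L lunitInv
  mul_assoc : ∀ a₁ a₂ b₁ b₂ : PosReal, a₁ + a₂ = b₁ + b₂ →
    μ a₁ ∘L tmap (.id ℂ A) (μ a₂) ∘L assoc = μ b₁ ∘L tmap (μ b₂) (.id ℂ A)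
  continuous_family : IsContinuousFamily fun a : PosReal =>
    μ (half a) ∘L tmap (.id ℂ A) (η (half a)) ∘L runitInv

/-- A regularised coalgebra structure on the Hilbert space `A`. As for regularised algebras, the
operator `P' a = (id ⊗ ε a₂) ∘ Δ a₁` is computed with `a₁ = a₂ = a / 2`. -/
structure RegCoalgebra (A : HilbSp.{u}) where
  /-- The coproduct. -/
  Δ : PosReal → (A →L[ℂ] HTensor A A)
  /-- The counit. -/
  ε : PosReal → (A →L[ℂ] ℂ)
  counit : ∀ a₁ a₂ b₁ b₂ : PosReal, a₁ + a₂ = b₁ + b₂ →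
    runit ∘L tmap (.id ℂ A) (ε a₂) ∘L Δ a₁ = lunit ∘L tmap (ε b₂) (.id ℂ A) ∘L Δ b₁
  comul_assoc : ∀ a₁ a₂ b₁ b₂ : PosReal, a₁ + a₂ = b₁ + b₂ →
    tmap (.id ℂ A) (Δ a₂) ∘L Δ a₁ = assoc ∘L tmap (Δ b₂) (.id ℂ A) ∘L Δ b₁
  cocontinuous_family : IsContinuousFamily fun a : PosReal =>
    runit ∘L tmap (.id ℂ A) (ε (half a)) ∘L Δ (half a)

/-- A regularised Frobenius algebra structure (RFA) on the Hilbert space `A`. -/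
structure RegFrobenius (A : HilbSp.{u}) extends RegAlgebra A, RegCoalgebra A where
  frobenius_left : ∀ a₁ a₂ c₁ c₂ : PosReal, a₁ + a₂ = c₁ + c₂ →
    tmap (.id ℂ A) (μ a₁) ∘L assoc ∘L tmap (Δ a₂) (.id ℂ A) = Δ c₁ ∘L μ c₂
  frobenius_right : ∀ b₁ b₂ c₁ c₂ : PosReal, b₁ + b₂ = c₁ + c₂ →
    tmap (μ b₁) (.id ℂ A) ∘L assocInv ∘L tmap (.id ℂ A) (Δ b₂) = Δ c₁ ∘L μ c₂

/-- A Hilbert space with an RFA structure. -/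
structure RFA : Type (u + 1) where
  /-- The underlying Hilbert space. -/
  space : HilbSp.{u}
  /-- The RFA structure. -/
  str : RegFrobenius space

/-- A morphism of RFAs: a bounded linear map compatible with the product, unit, coproduct and
counit. -/
@[ext]
structure RFAHom (A B : RFA.{u}) where
  /-- The underlying bounded linear map. -/
  map : A.space →L[ℂ] B.space
  map_mul : ∀ a, map ∘L A.str.μ a = B.str.μ a ∘L tmap map map
  map_unit : ∀ a, map ∘L A.str.η a = B.str.η a
  map_comul : ∀ a, tmap map map ∘L A.str.Δ a = B.str.Δ a ∘L map
  map_counit : ∀ a, B.str.ε a ∘L map = A.str.ε a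

/-- The category of RFAs in the category of Hilbert spaces. -/
instance : Category RFA.{u} where
  Hom := RFAHom
  id A :=
    { map := .id ℂ A.space
      map_mul := fun a => by rw [tmap_id]; rfl
      map_unit := fun a => rfl
      map_comul := fun a => by rw [tmap_id]; rfl
      map_counit := fun a => rfl }
  comp f g :=
    { map := g.map ∘L f.map
      map_mul := fun a => by
        rw [tmap_comp, ContinuousLinearMap.comp_assoc, f.map_mul, ← ContinuousLinearMap.comp_assoc,
          g.map_mul, ContinuousLinearMap.comp_assoc]
      map_unit := fun a => by rw [ContinuousLinearMap.comp_assoc, f.map_unit, g.map_unit]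
      map_comul := fun a => by
        rw [tmap_comp, ContinuousLinearMap.comp_assoc, f.map_comul,
          ← ContinuousLinearMap.comp_assoc, g.map_comul, ContinuousLinearMap.comp_assoc]
      map_counit := fun a => by
        rw [← ContinuousLinearMap.comp_assoc, g.map_counit, f.map_counit] }

/-- An RFA is Hermitian if `(μ a)† = Δ a` and `(η a)† = ε a` for all `a > 0`. -/
def IsHermitian : ObjectProperty RFA.{u} := fun A =>
  ∀ a, ContinuousLinearMap.adjoint (A.str.μ a) = A.str.Δ a ∧
    ContinuousLinearMap.adjoint (A.str.η a) = A.str.ε a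

/-- The category of Hermitian RFAs, a full subcategory of the category of RFAs. -/
abbrev DaggerRFA : Type (u + 1) := IsHermitian.FullSubcategory (C := RFA.{u})

/-! ### Frobenius algebras -/

/-- A Frobenius algebra structure on the Hilbert space `A`. -/
structure Frobenius (A : HilbSp.{u}) where
  /-- The product. -/
  μ : HTensor A A →L[ℂ] A
  /-- The unit. -/
  η : ℂ →L[ℂ] A
  /-- The coproduct. -/
  Δ : A →L[ℂ] HTensor A A
  /-- The counit. -/
  ε : A →L[ℂ] ℂ
  mul_unit : μ ∘L tmap (.id ℂ A) η ∘L runitInv = .id ℂ A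
  unit_mul : μ ∘L tmap η (.id ℂ A) ∘L lunitInv = .id ℂ A
  mul_assoc : μ ∘L tmap (.id ℂ A) μ ∘L assoc = μ ∘L tmap μ (.id ℂ A)
  comul_counit : runit ∘L tmap (.id ℂ A) ε ∘L Δ = .id ℂ A
  counit_comul : lunit ∘L tmap ε (.id ℂ A) ∘L Δ = .id ℂ A
  comul_assoc : tmap (.id ℂ A) Δ ∘L Δ = assoc ∘L tmap Δ (.id ℂ A) ∘L Δ
  frobenius_left : tmap (.id ℂ A) μ ∘L assoc ∘L tmap Δ (.id ℂ A) = Δ ∘L μ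
  frobenius_right : tmap μ (.id ℂ A) ∘L assocInv ∘L tmap (.id ℂ A) Δ = Δ ∘L μ

/-- A `†`-Frobenius algebra structure on the Hilbert space `A`: a Frobenius algebra with `μ† = Δ`
and `η† = ε`. -/
structure DaggerFrobenius (A : HilbSp.{u}) extends Frobenius A where
  adjoint_mul : ContinuousLinearMap.adjoint μ = Δ
  adjoint_unit : ContinuousLinearMap.adjoint η = ε

/-- The bounded linear map `φ` is a morphism of Frobenius algebras. -/
structure IsFrobeniusHom {A B : HilbSp.{u}} (S : Frobenius A) (T : Frobenius B)
    (φ : A →L[ℂ] B) : Prop where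
  map_mul : φ ∘L S.μ = T.μ ∘L tmap φ φ
  map_unit : φ ∘L S.η = T.η
  map_comul : tmap φ φ ∘L S.Δ = T.Δ ∘L φ
  map_counit : T.ε ∘L φ = S.ε

theorem IsFrobeniusHom.id {A : HilbSp.{u}} (S : Frobenius A) : IsFrobeniusHom S S (.id ℂ A) where
  map_mul := by rw [tmap_id]; rfl
  map_unit := rfl
  map_comul := by rw [tmap_id]; rfl
  map_counit := rfl

theorem IsFrobeniusHom.comp {A B C : HilbSp.{u}} {S : Frobenius A} {T : Frobenius B}
    {U : Frobenius C} {ψ : B →L[ℂ] C} {φ : A →L[ℂ] B} (hψ : IsFrobeniusHom T U ψ)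
    (hφ : IsFrobeniusHom S T φ) : IsFrobeniusHom S U (ψ ∘L φ) where
  map_mul := by
    rw [tmap_comp, ContinuousLinearMap.comp_assoc, hφ.map_mul, ← ContinuousLinearMap.comp_assoc,
      hψ.map_mul, ContinuousLinearMap.comp_assoc]
  map_unit := by rw [ContinuousLinearMap.comp_assoc, hφ.map_unit, hψ.map_unit]
  map_comul := by
    rw [tmap_comp, ContinuousLinearMap.comp_assoc, hφ.map_comul,
      ← ContinuousLinearMap.comp_assoc, hψ.map_comul, ContinuousLinearMap.comp_assoc]
  map_counit := by rw [← ContinuousLinearMap.comp_assoc, hψ.map_counit, hφ.map_counit]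

/-! ### The RFA with `P a = e ^ (-a σ)` on a Frobenius algebra -/

/-- The factor `e ^ (-a σ)`. -/
def decay (σ : ℝ) (a : PosReal) : ℂ := (Real.exp (-(a * σ)) : ℝ)

theorem decay_mul (σ : ℝ) (a b : PosReal) : decay σ a * decay σ b = decay σ (a + b) := by
  rw [decay, decay, decay, ← Complex.ofReal_mul, ← Real.exp_add]
  congr 2
  rw [show ((a + b : PosReal) : ℝ) = a + b from rfl]
  ring

theorem tpowMap_smul_id (A : HilbSp.{u}) (n : ℕ) (c : Fin (n + 1) → ℂ) :
    tpowMap A n (fun i => c i • .id ℂ A) = (∏ i, c i) • .id ℂ (tpow A n) := by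
  induction n with
  | zero =>
    rw [show ∏ i : Fin (0 + 1), c i = c 0 from Fin.prod_univ_one c]
    rfl
  | succ n ih =>
    rw [tpowMap, ih (fun i => c i.succ), tmap_smul_left, tmap_smul_right, tmap_id, smul_smul,
      ← Fin.prod_univ_succ]
    rfl

theorem isContinuousFamily_decay (A : HilbSp.{u}) (σ : ℝ) :
    IsContinuousFamily fun a : PosReal => decay σ a • .id ℂ A where
  tendsto_id x := by
    have h : Filter.Tendsto (fun t : ℝ => ((Real.exp (-(t * σ)) : ℝ) : ℂ) • x) (𝓝 0) (𝓝 x) := by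
      have hc : Continuous (fun t : ℝ => ((Real.exp (-(t * σ)) : ℝ) : ℂ) • x) := by fun_prop
      simpa using hc.tendsto 0
    exact h.comp Filter.tendsto_comap
  jointly_continuous n z := by
    have h : ∀ t : ℝ≥0, extendZero (fun a : PosReal => decay σ a • .id ℂ A) t =
        ((Real.exp (-((t : ℝ) * σ)) : ℝ) : ℂ) • .id ℂ A := by
      intro t
      by_cases ht : 0 < (t : ℝ)
      · simp only [extendZero, ht, dite_true]; rfl
      · have h0 : (t : ℝ) = 0 := le_antisymm (not_lt.mp ht) t.2
        simp [extendZero, h0]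
    simp only [h, tpowMap_smul_id]
    have hc : Continuous fun t : Fin (n + 1) → ℝ≥0 =>
        ∏ i, ((Real.exp (-((t i : ℝ) * σ)) : ℝ) : ℂ) := by fun_prop
    exact hc.smul continuous_const

/-- The RFA `μ a = e ^ (-a σ) μ`, `η a = e ^ (-a σ) η`, `Δ a = e ^ (-a σ) Δ`, `ε a = e ^ (-a σ) ε`
obtained from a Frobenius algebra and a real number `σ`; it has `P a = e ^ (-a σ) id`. -/
def Frobenius.regularise {A : HilbSp.{u}} (S : Frobenius A) (σ : ℝ) : RegFrobenius A where
  μ a := decay σ a • S.μ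
  η a := decay σ a • S.η
  Δ a := decay σ a • S.Δ
  ε a := decay σ a • S.ε
  unit a₁ a₂ b₁ b₂ h := by
    rw [add_comm a₁, add_comm b₁] at h
    simp only [tmap_smul_left, tmap_smul_right, ContinuousLinearMap.smul_comp,
      ContinuousLinearMap.comp_smul, smul_smul, decay_mul, h, S.mul_unit, S.unit_mul]
  mul_assoc a₁ a₂ b₁ b₂ h := by
    rw [add_comm a₁, add_comm b₁] at h
    simp only [tmap_smul_left, tmap_smul_right, ContinuousLinearMap.smul_comp,
      ContinuousLinearMap.comp_smul, smul_smul, decay_mul, h, S.mul_assoc]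
  continuous_family := by
    simp only [tmap_smul_right, ContinuousLinearMap.smul_comp,
      ContinuousLinearMap.comp_smul, smul_smul, decay_mul, half_add_half, S.mul_unit]
    exact isContinuousFamily_decay A σ
  counit a₁ a₂ b₁ b₂ h := by
    simp only [tmap_smul_left, tmap_smul_right, ContinuousLinearMap.smul_comp,
      ContinuousLinearMap.comp_smul, smul_smul, decay_mul, h, S.comul_counit,
      S.counit_comul]
  comul_assoc a₁ a₂ b₁ b₂ h := by
    simp only [tmap_smul_left, tmap_smul_right, ContinuousLinearMap.smul_comp,
      ContinuousLinearMap.comp_smul, smul_smul, decay_mul, h, S.comul_assoc]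
  cocontinuous_family := by
    simp only [tmap_smul_right, ContinuousLinearMap.smul_comp,
      ContinuousLinearMap.comp_smul, smul_smul, decay_mul, half_add_half, S.comul_counit]
    exact isContinuousFamily_decay A σ
  frobenius_left a₁ a₂ c₁ c₂ h := by
    rw [add_comm a₁, add_comm c₁] at h
    simp only [tmap_smul_left, tmap_smul_right, ContinuousLinearMap.smul_comp,
      ContinuousLinearMap.comp_smul, smul_smul, decay_mul, h, S.frobenius_left]
  frobenius_right b₁ b₂ c₁ c₂ h := by
    rw [add_comm b₁, add_comm c₁] at h
    simp only [tmap_smul_left, tmap_smul_right, ContinuousLinearMap.smul_comp,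
      ContinuousLinearMap.comp_smul, smul_smul, decay_mul, h, S.frobenius_right]

/-- The Hermitian RFA with `P a = e ^ (-a σ)` on a `†`-Frobenius algebra, for real `σ`. -/
def DaggerFrobenius.regularise {A : HilbSp.{u}} (S : DaggerFrobenius A) (σ : ℝ) :
    DaggerRFA.{u} where
  obj := ⟨A, S.toFrobenius.regularise σ⟩
  property a := by
    have h : (starRingEnd ℂ) (decay σ a) = decay σ a := Complex.conj_ofReal _
    constructor
    · simp only [Frobenius.regularise, LinearIsometryEquiv.map_smulₛₗ, h, S.adjoint_mul]
    · simp only [Frobenius.regularise, LinearIsometryEquiv.map_smulₛₗ, h, S.adjoint_unit]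

/-! ### Families of `†`-Frobenius algebras -/

/-- A countable family `{F j, σ j}` of `†`-Frobenius algebras and real numbers satisfying the
convergence conditions. -/
structure FrobFamily : Type (u + 1) where
  /-- The index set. -/
  I : Type
  [countable : Countable I]
  /-- The underlying Hilbert spaces. -/
  F : I → HilbSp.{u}
  /-- The `†`-Frobenius algebra structures. -/
  frob : ∀ j, DaggerFrobenius (F j)
  /-- The real numbers. -/
  σ : I → ℝ
  bddAbove_mul : ∀ a : ℝ, 0 < a →
    BddAbove (Set.range fun j => Real.exp (-(a * σ j)) * ‖(frob j).μ‖)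
  summable_unit : ∀ a : ℝ, 0 < a →
    Summable fun j => Real.exp (-(2 * a * σ j)) * ‖(frob j).η‖ ^ 2

/-- The Hermitian RFA with `P a = e ^ (-a σ j)` on the `j`-th member of a family. -/
def FrobFamily.summand (Φ : FrobFamily.{u}) (j : Φ.I) : DaggerRFA.{u} :=
  (Φ.frob j).regularise (Φ.σ j)

/-- A morphism of families: a bijection `f` of the index sets with `σ j = σ' (f j)`, and
morphisms of Frobenius algebras `ψ j : F j → F' (f j)` that are uniformly bounded, i.e. whose
direct sum is a bounded operator. -/
@[ext]
structure FrobFamilyHom (Φ Φ' : FrobFamily.{u}) where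
  /-- The bijection of the index sets. -/
  f : Φ.I ≃ Φ'.I
  /-- The morphisms of Frobenius algebras. -/
  ψ : ∀ j, Φ.F j →L[ℂ] Φ'.F (f j)
  σ_eq : ∀ j, Φ.σ j = Φ'.σ (f j)
  isHom : ∀ j, IsFrobeniusHom (Φ.frob j).toFrobenius (Φ'.frob (f j)).toFrobenius (ψ j)
  bounded : ∃ C : ℝ, ∀ j, ‖ψ j‖ ≤ C

/-- The category of countable families of `†`-Frobenius algebras and real numbers. -/
instance : Category FrobFamily.{u} where
  Hom := FrobFamilyHom
  id Φ :=
    { f := Equiv.refl _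
      ψ := fun j => .id ℂ (Φ.F j)
      σ_eq := fun _ => rfl
      isHom := fun j => IsFrobeniusHom.id _
      bounded := ⟨1, fun _ => ContinuousLinearMap.norm_id_le⟩ }
  comp {Φ Φ' Φ''} Ψ Ψ' :=
    { f := Ψ.f.trans Ψ'.f
      ψ := fun j => Ψ'.ψ (Ψ.f j) ∘L Ψ.ψ j
      σ_eq := fun j => (Ψ.σ_eq j).trans (Ψ'.σ_eq (Ψ.f j))
      isHom := fun j => (Ψ'.isHom (Ψ.f j)).comp (Ψ.isHom j)
      bounded := by
        obtain ⟨C, hC⟩ := Ψ.bounded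
        obtain ⟨C', hC'⟩ := Ψ'.bounded
        refine ⟨C' * C, fun j => ?_⟩
        exact (ContinuousLinearMap.opNorm_comp_le _ _).trans
          (mul_le_mul (hC' _) (hC j) (norm_nonneg _) ((norm_nonneg _).trans (hC' (Ψ.f j)))) }

/-- A family is reduced if its algebras are non-zero and its real numbers pairwise distinct. -/
def IsReduced : ObjectProperty FrobFamily.{u} := fun Φ =>
  (∀ j, Nontrivial (Φ.F j)) ∧ Function.Injective Φ.σ

/-! ### Hilbert direct sums of RFAs -/

/-- The RFA `A` is the Hilbert direct sum of the RFAs `B j`, with isometric inclusions `ι j`: the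
Hilbert space of `A` is the orthogonal Hilbert sum of those of the `B j`, and the structure maps of
`A` are the sums of those of the `B j` (in particular products of different summands vanish). -/
structure IsHilbertDirectSum {I : Type} (B : I → RFA.{u}) (A : RFA.{u})
    (ι : ∀ j, (B j).space →ₗᵢ[ℂ] A.space) : Prop where
  isHilbertSum : IsHilbertSum ℂ (fun j => (B j).space) ι
  mul_same : ∀ (a : PosReal) j (x y : (B j).space),
    A.str.μ a (tmul (ι j x) (ι j y)) = ι j ((B j).str.μ a (tmul x y))
  mul_ne : ∀ (a : PosReal) j k, j ≠ k → ∀ (x : (B j).space) (y : (B k).space),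
    A.str.μ a (tmul (ι j x) (ι k y)) = 0
  unit : ∀ a : PosReal, HasSum (fun j => ι j ((B j).str.η a 1)) (A.str.η a 1)
  comul : ∀ (a : PosReal) j (x : (B j).space),
    A.str.Δ a (ι j x) =
      tmap (ι j).toContinuousLinearMap (ι j).toContinuousLinearMap ((B j).str.Δ a x)
  counit : ∀ (a : PosReal) j (x : (B j).space), A.str.ε a (ι j x) = (B j).str.ε a x

end HermRFA

end

/-!
# Hermitian regularised Frobenius algebras are direct sums of `†`-Frobenius algebras

The functor. For a family `{F j, σ j}` the structure maps `e ^ (-a σ j) μ j` are uniformly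
bounded, so their orthogonal sum `FrobFamily.sumMul` is a bounded product on the `ℓ²`-sum, and the
vectors `e ^ (-a σ j) η j 1` are square-summable, so they are the components of a unit. Coproduct
and counit are the adjoints. Every axiom is an identity of bounded operators, so it only has to be
checked on tensor products of summands (`IsTotal.ext`), where the products of different summands
vanish and each summand satisfies the axiom (`sumFrobenius`). The operator `P a` is diagonal with
entries `e ^ (-a σ j)`; it is locally bounded in `a`, which reduces joint strong continuity to
single summands (`isContinuousFamily_of_isHilbertSum`).

Full faithfulness. A morphism of RFAs commutes with the operators `P a`, so it cannot have a
non-zero component between summands with different `σ` (`FrobFamily.component_eq_zero`). For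
reduced families the `σ j` are distinct, and since a morphism preserves units and counits, each
`σ j` of the source occurs in the target and conversely. This gives the bijection of the index
sets, and the remaining components are morphisms of Frobenius algebras
(`FrobFamily.exists_directSumMap_eq`).

Essential surjectivity. In a Hermitian RFA the operators `P a` form a strongly continuous
semigroup (`RFA.P_P`). The Frobenius relation shows that `P a` commutes with the coproduct, which
forces `P a` to be self-adjoint (`IsHermitian.adjoint_P_eq`), hence positive and, as `P a → id`,
injective. The same relation also writes `P a` as the contraction of the vector `Δ η ∈ A ⊗ A` with
the bounded form `ε μ`; approximating that vector by algebraic tensors exhibits `P a` as a norm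
limit of finite rank operators (`IsHermitian.isCompactOperator_P`). By the spectral theorem, `A`
is the Hilbert sum of the eigenspaces of `P 1`, which are finite-dimensional with eigenvalues
`e ^ (-σ) > 0` (`IsHermitian.isHilbertSum_expSpace`), and by uniqueness of positive square roots
and strong continuity `P a` acts on them by `e ^ (-a σ)` (`IsHermitian.mem_expSpace`). As `P` can be
moved between the two factors of a product, different eigenspaces multiply to zero, and each
eigenspace, after rescaling, is a `†`-Frobenius algebra (`IsHermitian.expFrobenius`). Only
countably many are non-zero, because the unit of `A` has a non-zero component in each of them.
-/

noncomputable section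

namespace HermRFA

open ContinuousLinearMap (adjoint)
open Filter (Tendsto)

/-! ### Tensor products of operators and their adjoints -/

section TensorCalculus

variable {E E' E'' F F' F'' G G' H : Type*}
  [NormedAddCommGroup E] [InnerProductSpace ℂ E] [NormedAddCommGroup F] [InnerProductSpace ℂ F]
  [NormedAddCommGroup G] [InnerProductSpace ℂ G] [NormedAddCommGroup G'] [InnerProductSpace ℂ G']
  [NormedAddCommGroup H] [InnerProductSpace ℂ H]
  [NormedAddCommGroup E'] [InnerProductSpace ℂ E'] [NormedAddCommGroup F'] [InnerProductSpace ℂ F']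

theorem inner_tmul (x x' : E) (y y' : F) :
    inner ℂ (tmul x y) (tmul x' y') = inner ℂ x x' * inner ℂ y y' := by
  simp [tmul, UniformSpace.Completion.inner_coe]

theorem norm_tmap_le (f : E →L[ℂ] E') (g : F →L[ℂ] F') : ‖tmap f g‖ ≤ ‖f‖ * ‖g‖ := by
  refine ContinuousLinearMap.opNorm_le_bound _ (by positivity) fun z => ?_
  induction z using UniformSpace.Completion.induction_on with
  | hp => exact isClosed_le (tmap f g).continuous.norm (continuous_const.mul continuous_norm)
  | ih t =>
    rw [tmap, ContinuousLinearMap.completion_apply_coe, UniformSpace.Completion.norm_coe,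
      UniformSpace.Completion.norm_coe]
    exact (ContinuousLinearMap.le_opNorm _ _).trans
      (mul_le_mul_of_nonneg_right (TensorProduct.norm_mapL_le f g) (norm_nonneg _))

/-- A vector of the tensor product is determined by its inner products with elementary tensors. -/
theorem eq_of_inner_tmul {u v : HTensor E F}
    (h : ∀ x y, inner ℂ (tmul x y) u = inner ℂ (tmul x y) v) : u = v :=
  ext_inner_left ℂ fun z => by
    have := DFunLike.congr_fun (ext_tmul (f := innerSL ℂ u) (g := innerSL ℂ v) fun x y => by
      simpa using congrArg (starRingEnd ℂ) (h x y)) z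
    simpa using congrArg (starRingEnd ℂ) this

theorem ext_tmul_left {f g : HTensor (HTensor E F) G →L[ℂ] H}
    (h : ∀ x y z, f (tmul (tmul x y) z) = g (tmul (tmul x y) z)) : f = g :=
  ext_tmul fun s z => DFunLike.congr_fun
    (ext_tmul (f := f ∘L UniformSpace.Completion.toComplL ∘L (TensorProduct.mkL ℂ _ G).flip z)
      (g := g ∘L UniformSpace.Completion.toComplL ∘L (TensorProduct.mkL ℂ _ G).flip z)
      fun x y => h x y z) s

theorem ext_tmul_right {f g : HTensor E (HTensor F G) →L[ℂ] H}
    (h : ∀ x y z, f (tmul x (tmul y z)) = g (tmul x (tmul y z))) : f = g :=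
  ext_tmul fun x s => DFunLike.congr_fun
    (ext_tmul (f := f ∘L UniformSpace.Completion.toComplL ∘L TensorProduct.mkL ℂ E _ x)
      (g := g ∘L UniformSpace.Completion.toComplL ∘L TensorProduct.mkL ℂ E _ x)
      fun y z => h x y z) s

theorem adjoint_tmap [CompleteSpace E] [CompleteSpace E'] [CompleteSpace F] [CompleteSpace F']
    (f : E →L[ℂ] E') (g : F →L[ℂ] F') :
    adjoint (tmap f g) = tmap (adjoint f) (adjoint g) :=
  ext_tmul fun x y => eq_of_inner_tmul fun x' y' => by
    rw [ContinuousLinearMap.adjoint_inner_right, tmap_tmul, tmap_tmul, inner_tmul, inner_tmul,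
      ContinuousLinearMap.adjoint_inner_right, ContinuousLinearMap.adjoint_inner_right]

theorem assoc_comp_tmap (f : E →L[ℂ] E') (g : F →L[ℂ] F') (h : G →L[ℂ] G') :
    assoc ∘L tmap (tmap f g) h = tmap f (tmap g h) ∘L assoc :=
  ext_tmul_left fun x y z => by simp [tmap_tmul, assoc_tmul]

theorem assocInv_comp_tmap (f : E →L[ℂ] E') (g : F →L[ℂ] F') (h : G →L[ℂ] G') :
    assocInv ∘L tmap f (tmap g h) = tmap (tmap f g) h ∘L assocInv :=
  ext_tmul_right fun x y z => by simp [tmap_tmul, assocInv_tmul]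

variable [CompleteSpace E] [CompleteSpace E']

theorem adjoint_lunit : adjoint (lunit : HTensor ℂ E →L[ℂ] E) = lunitInv := by
  ext x
  refine eq_of_inner_tmul fun c y => ?_
  rw [ContinuousLinearMap.adjoint_inner_right, lunit_tmul, lunitInv_apply, inner_tmul,
    inner_smul_left]
  simp

theorem adjoint_runit : adjoint (runit : HTensor E ℂ →L[ℂ] E) = runitInv := by
  ext x
  refine eq_of_inner_tmul fun y c => ?_
  rw [ContinuousLinearMap.adjoint_inner_right, runit_tmul, runitInv_apply, inner_tmul,
    inner_smul_left]
  simp [mul_comm]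

theorem adjoint_runitInv : adjoint (runitInv : E →L[ℂ] HTensor E ℂ) = runit := by
  rw [← adjoint_runit, ContinuousLinearMap.adjoint_adjoint]

theorem lunit_comp_tmap (f : E →L[ℂ] E') : lunit ∘L tmap (.id ℂ ℂ) f = f ∘L lunit :=
  ext_tmul fun c x => by simp [tmap_tmul, lunit_tmul]

theorem runit_comp_tmap (f : E →L[ℂ] E') : runit ∘L tmap f (.id ℂ ℂ) = f ∘L runit :=
  ext_tmul fun x c => by simp [tmap_tmul, runit_tmul]

end TensorCalculus

/-! ### Subspaces compatible with the structure maps -/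

/-! The map `i` is thought of as the inclusion of a summand that intertwines structure maps of the
summand with those of the ambient space. Each composite occurring in an axiom is then intertwined by
tensor powers of `i`, so the axioms pass from the summand to the ambient space, and back when `i` is
an isometry. -/

section Intertwining

variable {E F : Type*} [NormedAddCommGroup E] [InnerProductSpace ℂ E]
  [NormedAddCommGroup F] [InnerProductSpace ℂ F] {i : F →L[ℂ] E}
  {m m' : HTensor E E →L[ℂ] E} {n n' : HTensor F F →L[ℂ] F}
  {d d' : E →L[ℂ] HTensor E E} {c c' : F →L[ℂ] HTensor F F}
  {e : E →L[ℂ] ℂ} {e' : F →L[ℂ] ℂ}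

theorem intertwine_mul_right (h : m ∘L tmap i i = i ∘L n) (h' : m' ∘L tmap i i = i ∘L n') :
    (m ∘L tmap (.id ℂ E) m' ∘L assoc) ∘L tmap (tmap i i) i =
      i ∘L n ∘L tmap (.id ℂ F) n' ∘L assoc := by
  refine ext_tmul_left fun x y z => ?_
  have h1 := DFunLike.congr_fun h (tmul x (n' (tmul y z)))
  have h2 := DFunLike.congr_fun h' (tmul y z)
  simp only [ContinuousLinearMap.comp_apply, tmap_tmul] at h1 h2
  simp [tmap_tmul, assoc_tmul, h1, h2]

theorem intertwine_mul_left (h : m ∘L tmap i i = i ∘L n) (h' : m' ∘L tmap i i = i ∘L n') :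
    (m ∘L tmap m' (.id ℂ E)) ∘L tmap (tmap i i) i = i ∘L n ∘L tmap n' (.id ℂ F) := by
  refine ext_tmul_left fun x y z => ?_
  have h1 := DFunLike.congr_fun h (tmul (n' (tmul x y)) z)
  have h2 := DFunLike.congr_fun h' (tmul x y)
  simp only [ContinuousLinearMap.comp_apply, tmap_tmul] at h1 h2
  simp [tmap_tmul, h1, h2]

theorem intertwine_comul_right (h : d ∘L i = tmap i i ∘L c) (h' : d' ∘L i = tmap i i ∘L c') :
    (tmap (.id ℂ E) d ∘L d') ∘L i = tmap i (tmap i i) ∘L tmap (.id ℂ F) c ∘L c' := by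
  rw [ContinuousLinearMap.comp_assoc, h', ← ContinuousLinearMap.comp_assoc, ← tmap_comp, h,
    ← ContinuousLinearMap.comp_assoc, ← tmap_comp, ContinuousLinearMap.id_comp,
    ContinuousLinearMap.comp_id]

theorem intertwine_comul_left (h : d ∘L i = tmap i i ∘L c) (h' : d' ∘L i = tmap i i ∘L c') :
    (assoc ∘L tmap d (.id ℂ E) ∘L d') ∘L i =
      tmap i (tmap i i) ∘L assoc ∘L tmap c (.id ℂ F) ∘L c' := by
  have h1 : tmap d (.id ℂ E) ∘L tmap i i = tmap (tmap i i) i ∘L tmap c (.id ℂ F) := by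
    rw [← tmap_comp, ← tmap_comp, h]
    rfl
  have h2 : (tmap d (.id ℂ E) ∘L d') ∘L i =
      tmap (tmap i i) i ∘L tmap c (.id ℂ F) ∘L c' := by
    rw [ContinuousLinearMap.comp_assoc, h', ← ContinuousLinearMap.comp_assoc, h1]
    rfl
  rw [ContinuousLinearMap.comp_assoc, h2, ← ContinuousLinearMap.comp_assoc, assoc_comp_tmap]
  rfl

theorem intertwine_frobenius_left (h : m ∘L tmap i i = i ∘L n) (h' : d ∘L i = tmap i i ∘L c) :
    (tmap (.id ℂ E) m ∘L assoc ∘L tmap d (.id ℂ E)) ∘L tmap i i =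
      tmap i i ∘L tmap (.id ℂ F) n ∘L assoc ∘L tmap c (.id ℂ F) := by
  have h1 : tmap d (.id ℂ E) ∘L tmap i i = tmap (tmap i i) i ∘L tmap c (.id ℂ F) := by
    rw [← tmap_comp, ← tmap_comp, h']
    rfl
  have h2 : tmap (.id ℂ E) m ∘L tmap i (tmap i i) = tmap i i ∘L tmap (.id ℂ F) n := by
    rw [← tmap_comp, ← tmap_comp, h]
    rfl
  rw [ContinuousLinearMap.comp_assoc, ContinuousLinearMap.comp_assoc, h1,
    ← ContinuousLinearMap.comp_assoc assoc, assoc_comp_tmap, ContinuousLinearMap.comp_assoc,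
    ← ContinuousLinearMap.comp_assoc, h2]
  rfl

theorem intertwine_frobenius_right (h : m ∘L tmap i i = i ∘L n) (h' : d ∘L i = tmap i i ∘L c) :
    (tmap m (.id ℂ E) ∘L assocInv ∘L tmap (.id ℂ E) d) ∘L tmap i i =
      tmap i i ∘L tmap n (.id ℂ F) ∘L assocInv ∘L tmap (.id ℂ F) c := by
  have h1 : tmap (.id ℂ E) d ∘L tmap i i = tmap i (tmap i i) ∘L tmap (.id ℂ F) c := by
    rw [← tmap_comp, ← tmap_comp, h']
    rfl
  have h2 : tmap m (.id ℂ E) ∘L tmap (tmap i i) i = tmap i i ∘L tmap n (.id ℂ F) := by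
    rw [← tmap_comp, ← tmap_comp, h]
    rfl
  rw [ContinuousLinearMap.comp_assoc, ContinuousLinearMap.comp_assoc, h1,
    ← ContinuousLinearMap.comp_assoc assocInv, assocInv_comp_tmap, ContinuousLinearMap.comp_assoc,
    ← ContinuousLinearMap.comp_assoc, h2]
  rfl

variable [CompleteSpace E] [CompleteSpace F]

theorem intertwine_counit_right (h : d ∘L i = tmap i i ∘L c) (h' : e ∘L i = e') :
    (runit ∘L tmap (.id ℂ E) e ∘L d) ∘L i = i ∘L runit ∘L tmap (.id ℂ F) e' ∘L c := by
  have h1 : tmap (.id ℂ E) e ∘L tmap i i = tmap i (.id ℂ ℂ) ∘L tmap (.id ℂ F) e' := by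
    rw [← tmap_comp, ← tmap_comp, h']
    rfl
  rw [ContinuousLinearMap.comp_assoc, ContinuousLinearMap.comp_assoc, h,
    ← ContinuousLinearMap.comp_assoc _ _ c, h1, ContinuousLinearMap.comp_assoc,
    ← ContinuousLinearMap.comp_assoc, runit_comp_tmap]
  rfl

theorem intertwine_counit_left (h : d ∘L i = tmap i i ∘L c) (h' : e ∘L i = e') :
    (lunit ∘L tmap e (.id ℂ E) ∘L d) ∘L i = i ∘L lunit ∘L tmap e' (.id ℂ F) ∘L c := by
  have h1 : tmap e (.id ℂ E) ∘L tmap i i = tmap (.id ℂ ℂ) i ∘L tmap e' (.id ℂ F) := by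
    rw [← tmap_comp, ← tmap_comp, h']
    rfl
  rw [ContinuousLinearMap.comp_assoc, ContinuousLinearMap.comp_assoc, h,
    ← ContinuousLinearMap.comp_assoc _ _ c, h1, ContinuousLinearMap.comp_assoc,
    ← ContinuousLinearMap.comp_assoc, lunit_comp_tmap]
  rfl

end Intertwining

section Zero

variable {E E' F F' : Type*}
  [NormedAddCommGroup E] [InnerProductSpace ℂ E] [NormedAddCommGroup F] [InnerProductSpace ℂ F]
  [NormedAddCommGroup E'] [InnerProductSpace ℂ E'] [NormedAddCommGroup F'] [InnerProductSpace ℂ F']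

theorem tmap_zero_left (g : F →L[ℂ] F') : tmap (0 : E →L[ℂ] E') g = 0 := by
  have := tmap_smul_left 0 (0 : E →L[ℂ] E') g
  rwa [zero_smul, zero_smul] at this

theorem tmap_zero_right (f : E →L[ℂ] E') : tmap f (0 : F →L[ℂ] F') = 0 := by
  have := tmap_smul_right 0 f (0 : F →L[ℂ] F')
  rwa [zero_smul, zero_smul] at this

theorem zero_tmul (y : F) : tmul (0 : E) y = 0 := by
  simpa using tmul_smul_left 0 (0 : E) y

theorem tmul_zero (x : E) : tmul x (0 : F) = 0 := by
  simpa using tmul_smul_right 0 x (0 : F)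

end Zero

/-! ### Total families of operators -/

section Total

variable {I J : Type*} {E F H : Type*} {G : I → Type*} {K : J → Type*}
  [NormedAddCommGroup E] [InnerProductSpace ℂ E] [NormedAddCommGroup F] [InnerProductSpace ℂ F]
  [NormedAddCommGroup H] [InnerProductSpace ℂ H]
  [∀ i, NormedAddCommGroup (G i)] [∀ i, InnerProductSpace ℂ (G i)]
  [∀ j, NormedAddCommGroup (K j)] [∀ j, InnerProductSpace ℂ (K j)]

/-- A family of operators is total if its ranges together span a dense subspace. -/
def IsTotal (V : ∀ i, G i →L[ℂ] E) : Prop :=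
  ∀ S : Submodule ℂ E, IsClosed (S : Set E) → (∀ i x, V i x ∈ S) → ∀ z, z ∈ S

theorem IsTotal.ext {V : ∀ i, G i →L[ℂ] E} (hV : IsTotal V) {f g : E →L[ℂ] H}
    (h : ∀ i, f ∘L V i = g ∘L V i) : f = g := by
  ext z
  have := hV (f - g).ker (f - g).isClosed_ker (fun i x => by
    simpa [sub_eq_zero] using DFunLike.congr_fun (h i) x) z
  simpa [sub_eq_zero] using this

theorem IsTotal.tmap {V : ∀ i, G i →L[ℂ] E} {W : ∀ j, K j →L[ℂ] F} (hV : IsTotal V)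
    (hW : IsTotal W) : IsTotal fun p : I × J => tmap (V p.1) (W p.2) := by
  intro S hS h z
  refine tmul_mem_of_forall hS (fun x y => ?_) z
  refine hV (S.comap (UniformSpace.Completion.toComplL ∘L
    (TensorProduct.mkL ℂ E F).flip y).toLinearMap)
    (hS.preimage (continuous_tmul_left y)) (fun i u => ?_) x
  refine hW (S.comap (UniformSpace.Completion.toComplL ∘L
    TensorProduct.mkL ℂ E F (V i u)).toLinearMap)
    (hS.preimage (continuous_tmul_right (V i u))) (fun j w => ?_) y
  have := h (i, j) (tmul u w)
  rwa [tmap_tmul] at this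

theorem isTotal_of_isHilbertSum [CompleteSpace E] {V : ∀ i, G i →ₗᵢ[ℂ] E}
    (hV : IsHilbertSum ℂ G V) : IsTotal fun i => (V i).toContinuousLinearMap := by
  intro S hS h z
  obtain ⟨w, rfl⟩ := hV.surjective_isometry z
  exact hS.mem_of_tendsto (hV.OrthogonalFamily.hasSum_linearIsometry w)
    (Filter.Eventually.of_forall fun s => S.sum_mem fun i _ => h i _)

end Total

/-! ### Orthogonal sums of operators -/

section OrthogonalSum

variable {I : Type*} {G G' : I → Type*} {E E' F F' : Type*}
  [NormedAddCommGroup E] [InnerProductSpace ℂ E] [CompleteSpace E]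
  [NormedAddCommGroup E'] [InnerProductSpace ℂ E'] [CompleteSpace E']
  [NormedAddCommGroup F] [InnerProductSpace ℂ F] [NormedAddCommGroup F'] [InnerProductSpace ℂ F']
  [∀ i, NormedAddCommGroup (G i)] [∀ i, InnerProductSpace ℂ (G i)]
  [∀ i, NormedAddCommGroup (G' i)] [∀ i, InnerProductSpace ℂ (G' i)]

/-- The tensor product of two isometries, as an isometry. -/
def tmapIsometry (f : E →ₗᵢ[ℂ] E') (g : F →ₗᵢ[ℂ] F') : HTensor E F →ₗᵢ[ℂ] HTensor E' F' where
  toLinearMap := (tmap f.toContinuousLinearMap g.toContinuousLinearMap).toLinearMap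
  norm_map' z := by
    change ‖tmap f.toContinuousLinearMap g.toContinuousLinearMap z‖ = ‖z‖
    induction z using UniformSpace.Completion.induction_on with
    | hp => exact isClosed_eq (ContinuousLinearMap.continuous _).norm continuous_norm
    | ih t =>
      rw [tmap, ContinuousLinearMap.completion_apply_coe, UniformSpace.Completion.norm_coe,
        UniformSpace.Completion.norm_coe]
      rw [TensorProduct.mapL_apply]
      exact TensorProduct.norm_map f g t

theorem _root_.OrthogonalFamily.adjoint_apply_of_ne [∀ i, CompleteSpace (G i)]
    {V : ∀ i, G i →ₗᵢ[ℂ] E}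
    (hV : OrthogonalFamily ℂ G V) {i j : I} (h : i ≠ j) (x : G j) :
    adjoint (V i).toContinuousLinearMap (V j x) = 0 :=
  ext_inner_left ℂ fun y => by
    rw [ContinuousLinearMap.adjoint_inner_right, inner_zero_right]
    exact hV h y x

theorem adjoint_apply_self {F : Type*} [NormedAddCommGroup F] [InnerProductSpace ℂ F]
    [CompleteSpace F] (f : F →ₗᵢ[ℂ] E) (x : F) :
    adjoint f.toContinuousLinearMap (f x) = x :=
  ext_inner_left ℂ fun y => by
    rw [ContinuousLinearMap.adjoint_inner_right]
    exact f.inner_map_map y x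

theorem _root_.OrthogonalFamily.tmapIsometry [∀ i, CompleteSpace (G i)] {V : ∀ i, G i →ₗᵢ[ℂ] E}
    (hV : OrthogonalFamily ℂ G V) :
    OrthogonalFamily ℂ (fun i => HTensor (G i) (G i)) fun i => tmapIsometry (V i) (V i) := by
  intro i j h z w
  have h0 : adjoint (V i).toContinuousLinearMap ∘L (V j).toContinuousLinearMap = 0 := by
    ext x
    exact hV.adjoint_apply_of_ne h x
  have h1 : adjoint (tmap (V i).toContinuousLinearMap (V i).toContinuousLinearMap) ∘L
      tmap (V j).toContinuousLinearMap (V j).toContinuousLinearMap = 0 := by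
    rw [adjoint_tmap, ← tmap_comp, h0, tmap_zero_left]
  change inner ℂ (tmap (V i).toContinuousLinearMap (V i).toContinuousLinearMap z)
      (tmap (V j).toContinuousLinearMap (V j).toContinuousLinearMap w) = 0
  rw [← ContinuousLinearMap.adjoint_inner_right, ← ContinuousLinearMap.comp_apply, h1]
  simp

/-- The direct sum `⨁ f i` of uniformly bounded operators, as an operator between `ℓ²`-sums. -/
def lpMap (f : ∀ i, G i →L[ℂ] G' i) (C : ℝ) (hf : ∀ i, ‖f i‖ ≤ C) :
    lp G 2 →L[ℂ] lp G' 2 :=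
  have hle : ∀ (w : lp G 2) i, ‖f i (w i)‖ ≤ ‖((|C| : ℝ) : ℂ) • w i‖ := fun w i => by
    rw [norm_smul, Complex.norm_real, Real.norm_eq_abs, abs_abs]
    exact (f i).le_of_opNorm_le ((hf i).trans (le_abs_self C)) _
  have hmem : ∀ w : lp G 2, Memℓp (fun i => f i (w i)) 2 := fun w => by
    have h2 : 0 < (2 : ENNReal).toReal := by norm_num
    have h := (memℓp_gen_iff h2).1 (lp.memℓp (((|C| : ℝ) : ℂ) • w))
    refine memℓp_gen (h.of_nonneg_of_le (fun i => by positivity) fun i => ?_)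
    exact Real.rpow_le_rpow (norm_nonneg _) (hle w i) h2.le
  LinearMap.mkContinuous
    { toFun := fun w => ⟨fun i => f i (w i), hmem w⟩
      map_add' := fun w w' => by ext i; exact map_add (f i) (w i) (w' i)
      map_smul' := fun c w => by ext i; exact map_smul (f i) c (w i) } |C| fun w => by
    have := lp.norm_mono (p := 2) two_ne_zero (x := ⟨fun i => f i (w i), hmem w⟩)
      (y := ((|C| : ℝ) : ℂ) • w) (hle w)
    rw [norm_smul, Complex.norm_real, Real.norm_eq_abs, abs_abs] at this
    exact this

theorem lpMap_apply (f : ∀ i, G i →L[ℂ] G' i) (C : ℝ) (hf : ∀ i, ‖f i‖ ≤ C) (w : lp G 2) (i : I) :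
    lpMap f C hf w i = f i (w i) := rfl

variable [∀ i, CompleteSpace (G i)]

/-- The operator that acts as `f i : G i → G' i` between the members of two orthogonal families
and vanishes on the orthogonal complement of the first family. -/
def orthoSum {V : ∀ i, G i →ₗᵢ[ℂ] E} {W : ∀ i, G' i →ₗᵢ[ℂ] E'} (hV : OrthogonalFamily ℂ G V)
    (hW : OrthogonalFamily ℂ G' W) (f : ∀ i, G i →L[ℂ] G' i) (C : ℝ) (hf : ∀ i, ‖f i‖ ≤ C) :
    E →L[ℂ] E' :=
  hW.linearIsometry.toContinuousLinearMap ∘L lpMap f C hf ∘L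
    adjoint hV.linearIsometry.toContinuousLinearMap

variable {V : ∀ i, G i →ₗᵢ[ℂ] E} {W : ∀ i, G' i →ₗᵢ[ℂ] E'} (hV : OrthogonalFamily ℂ G V)
  (hW : OrthogonalFamily ℂ G' W) (f : ∀ i, G i →L[ℂ] G' i) (C : ℝ) (hf : ∀ i, ‖f i‖ ≤ C)

theorem adjoint_linearIsometry_apply (z : E) (i : I) :
    adjoint hV.linearIsometry.toContinuousLinearMap z i =
      adjoint (V i).toContinuousLinearMap z := by
  classical
  refine ext_inner_left ℂ fun x => ?_
  rw [← lp.inner_single_left, ContinuousLinearMap.adjoint_inner_right,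
    ContinuousLinearMap.adjoint_inner_right, LinearIsometry.coe_toContinuousLinearMap,
    hV.linearIsometry_apply_single, LinearIsometry.coe_toContinuousLinearMap]

theorem hasSum_orthoSum (z : E) :
    HasSum (fun i => W i (f i (adjoint (V i).toContinuousLinearMap z)))
      (orthoSum hV hW f C hf z) := by
  have := hW.hasSum_linearIsometry
    (lpMap f C hf (adjoint hV.linearIsometry.toContinuousLinearMap z))
  simp only [lpMap_apply, adjoint_linearIsometry_apply] at this
  exact this

theorem orthoSum_apply (i : I) (x : G i) : orthoSum hV hW f C hf (V i x) = W i (f i x) := by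
  refine (hasSum_orthoSum hV hW f C hf (V i x)).unique ?_
  have := hasSum_single (f := fun k => W k (f k (adjoint (V k).toContinuousLinearMap (V i x)))) i
    fun j hj => by rw [hV.adjoint_apply_of_ne hj, map_zero, map_zero]
  rwa [adjoint_apply_self] at this

theorem orthoSum_eq_zero {z : E} (hz : ∀ i, adjoint (V i).toContinuousLinearMap z = 0) :
    orthoSum hV hW f C hf z = 0 := by
  refine (hasSum_orthoSum hV hW f C hf z).unique ?_
  simp only [hz, map_zero]
  exact hasSum_zero

theorem adjoint_orthoSum [∀ i, CompleteSpace (G' i)] : adjoint (orthoSum hV hW f C hf) =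
    orthoSum hW hV (fun i => adjoint (f i)) C
      fun i => (LinearIsometryEquiv.norm_map _ _).trans_le (hf i) := by
  symm
  rw [ContinuousLinearMap.eq_adjoint_iff]
  intro z w
  have h1 := (hasSum_orthoSum hW hV (fun i => adjoint (f i)) C
      (fun i => (LinearIsometryEquiv.norm_map _ _).trans_le (hf i)) z).mapL (innerSL ℂ w)
  have h2 := (hasSum_orthoSum hV hW f C hf w).mapL (innerSL ℂ z)
  rw [← inner_conj_symm]
  refine (h1.star.unique ?_)
  convert! h2 using 1
  ext i
  have e1 := ContinuousLinearMap.adjoint_inner_right (V i).toContinuousLinearMap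
    (adjoint (f i) (adjoint (W i).toContinuousLinearMap z)) w
  have e2 := ContinuousLinearMap.adjoint_inner_left (W i).toContinuousLinearMap
    (f i (adjoint (V i).toContinuousLinearMap w)) z
  simp only [innerSL_apply_apply, LinearIsometry.coe_toContinuousLinearMap] at *
  rw [RCLike.star_def, inner_conj_symm, ← e1, ← e2, ContinuousLinearMap.adjoint_inner_left]

end OrthogonalSum

/-! ### Parameters tending to zero -/

/-- The filter on the positive reals of parameters tending to `0`. -/
abbrev atZero : Filter PosReal := Filter.comap Subtype.val (𝓝 (0 : ℝ))

/-- A positive real as a non-negative real. -/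
def PosReal.toNNReal (a : PosReal) : ℝ≥0 := ⟨a.1, a.2.le⟩

theorem extendZero_coe {A : HilbSp.{u}} (P : PosReal → A →L[ℂ] A) (a : PosReal) :
    extendZero P (PosReal.toNNReal a) = P a :=
  dif_pos a.2

theorem extendZero_zero {A : HilbSp.{u}} (P : PosReal → A →L[ℂ] A) :
    extendZero P 0 = .id ℂ A := by
  simp [extendZero]

theorem tendsto_atZero_coe : Tendsto PosReal.toNNReal atZero (𝓝 0) := by
  exact NNReal.tendsto_coe.1 Filter.tendsto_comap

/-! ### Strong continuity of tensor products -/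

section StrongContinuity

variable {X : Type*} [TopologicalSpace X] {E E' F F' : Type*}
  [NormedAddCommGroup E] [InnerProductSpace ℂ E] [NormedAddCommGroup F] [InnerProductSpace ℂ F]
  [NormedAddCommGroup E'] [InnerProductSpace ℂ E'] [NormedAddCommGroup F'] [InnerProductSpace ℂ F']

/-- Every point has a neighbourhood on which the operators are uniformly bounded. -/
def LocallyBdd (T : X → E →L[ℂ] E') : Prop := ∀ x, ∃ C : ℝ, ∀ᶠ y in 𝓝 x, ‖T y‖ ≤ C

/-- The vectors on which a family of operators depends continuously on the parameter. -/
def contVectors (T : X → E →L[ℂ] E') : Submodule ℂ E where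
  carrier := {z | Continuous fun x => T x z}
  add_mem' hz hw := by simpa using! Continuous.add hz hw
  zero_mem' := by simpa using continuous_const
  smul_mem' c z hz := by simpa using! Continuous.const_smul hz c

/-- Strong continuity extends from a set to its closure when the operators are locally bounded. -/
theorem isClosed_contVectors {T : X → E →L[ℂ] E'} (hT : LocallyBdd T) :
    IsClosed (contVectors T : Set E) := by
  rw [← closure_subset_iff_isClosed]
  intro z hz
  refine continuous_iff_continuousAt.2 fun x => ?_
  obtain ⟨C, hC⟩ := hT x
  refine continuousAt_of_locally_uniform_approx_of_continuousAt fun u hu => ?_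
  obtain ⟨ε, hε, hu⟩ := Metric.mem_uniformity_dist.1 hu
  obtain ⟨w, hw, hzw⟩ := Metric.mem_closure_iff.1 hz (ε / (|C| + 1)) (by positivity)
  refine ⟨_, hC, fun y => T y w, (show Continuous fun y => T y w from hw).continuousAt,
    fun y hy => hu ?_⟩
  rw [dist_eq_norm, ← map_sub]
  rw [dist_eq_norm, lt_div_iff₀ (by positivity), mul_comm] at hzw
  refine ((T y).le_opNorm _).trans_lt (lt_of_le_of_lt ?_ hzw)
  gcongr
  have hy' : ‖T y‖ ≤ C := hy
  linarith [le_abs_self C]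

theorem continuous_tmul : Continuous fun p : E × F => tmul p.1 p.2 :=
  (UniformSpace.Completion.continuous_coe _).comp TensorProduct.continuous_tmul

theorem LocallyBdd.tmap {T : X → E →L[ℂ] E'} {U : X → F →L[ℂ] F'} (hT : LocallyBdd T)
    (hU : LocallyBdd U) : LocallyBdd fun x => tmap (T x) (U x) := fun x => by
  obtain ⟨C, hC⟩ := hT x
  obtain ⟨D, hD⟩ := hU x
  refine ⟨|C| * |D|, ?_⟩
  filter_upwards [hC, hD] with y hy hy'
  exact (norm_tmap_le _ _).trans (mul_le_mul (hy.trans (le_abs_self C))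
    (hy'.trans (le_abs_self D)) (norm_nonneg _) (abs_nonneg C))

theorem continuous_tmap {T : X → E →L[ℂ] E'} {U : X → F →L[ℂ] F'} (hT : LocallyBdd T)
    (hU : LocallyBdd U) (hTc : ∀ z, Continuous fun x => T x z)
    (hUc : ∀ z, Continuous fun x => U x z) (z : HTensor E F) :
    Continuous fun x => tmap (T x) (U x) z := by
  refine tmul_mem_of_forall (isClosed_contVectors (hT.tmap hU)) (fun z w => ?_) z
  change Continuous fun x => tmap (T x) (U x) (tmul z w)
  simp only [tmap_tmul]
  exact continuous_tmul.comp ((hTc z).prodMk (hUc w))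

theorem continuous_tpowMap {A : HilbSp.{u}} (n : ℕ) {T : Fin (n + 1) → X → A →L[ℂ] A}
    (hT : ∀ i, LocallyBdd (T i)) (hTc : ∀ i z, Continuous fun x => T i x z) :
    LocallyBdd (fun x => tpowMap A n fun i => T i x) ∧
      ∀ z, Continuous fun x => tpowMap A n (fun i => T i x) z := by
  induction n with
  | zero => exact ⟨hT 0, hTc 0⟩
  | succ n ih =>
    obtain ⟨h1, h2⟩ := ih (fun i => hT i.succ) fun i => hTc i.succ
    exact ⟨(hT 0).tmap h1, continuous_tmap (hT 0) h1 (hTc 0) h2⟩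

end StrongContinuity

/-! ### Diagonal operators on a Hilbert sum -/

section DiagonalFamily

variable {I : Type*} {G : I → Type*} {A : HilbSp.{u}}
  [∀ i, NormedAddCommGroup (G i)] [∀ i, InnerProductSpace ℂ (G i)] [∀ i, CompleteSpace (G i)]
  {V : ∀ i, G i →ₗᵢ[ℂ] A}

theorem _root_.IsHilbertSum.adjoint_linearIsometry_norm
    (hV : IsHilbertSum ℂ G V) (z : A) :
    ‖adjoint hV.OrthogonalFamily.linearIsometry.toContinuousLinearMap z‖ = ‖z‖ := by
  obtain ⟨w, rfl⟩ := hV.surjective_isometry z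
  rw [adjoint_apply_self, LinearIsometry.norm_map]

/-- By Parseval, a bound on all components in a Hilbert sum is a bound on the vectors. -/
theorem _root_.IsHilbertSum.norm_le_of_component_le (hV : IsHilbertSum ℂ G V) {z w : A} {C : ℝ}
    (hC : 0 ≤ C) (h : ∀ i, ‖adjoint (V i).toContinuousLinearMap z‖ ≤
      C * ‖adjoint (V i).toContinuousLinearMap w‖) : ‖z‖ ≤ C * ‖w‖ := by
  rw [← hV.adjoint_linearIsometry_norm z, ← hV.adjoint_linearIsometry_norm w]
  have hc : ‖(C : ℂ)‖ = C := by simp [abs_of_nonneg hC]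
  rw [← hc, ← norm_smul]
  refine lp.norm_mono two_ne_zero fun i => ?_
  rw [lp.coeFn_smul, Pi.smul_apply, norm_smul, adjoint_linearIsometry_apply,
    adjoint_linearIsometry_apply, hc]
  exact h i

theorem _root_.IsHilbertSum.adjoint_apply_of_diagonal (hV : IsHilbertSum ℂ G V) {T : A →L[ℂ] A}
    {c : I → ℂ} (hT : ∀ i x, T (V i x) = c i • V i x) (i : I) (z : A) :
    adjoint (V i).toContinuousLinearMap (T z) = c i • adjoint (V i).toContinuousLinearMap z := by
  refine DFunLike.congr_fun ((isTotal_of_isHilbertSum hV).ext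
    (f := adjoint (V i).toContinuousLinearMap ∘L T)
    (g := c i • adjoint (V i).toContinuousLinearMap) fun k => ?_) z
  ext x
  simp only [ContinuousLinearMap.comp_apply, LinearIsometry.coe_toContinuousLinearMap, hT,
    map_smul, smul_apply]
  obtain rfl | hik := eq_or_ne i k
  · rfl
  · rw [hV.OrthogonalFamily.adjoint_apply_of_ne hik, smul_zero, smul_zero]

theorem _root_.IsHilbertSum.eq_of_component_eq (hV : IsHilbertSum ℂ G V) {z w : A}
    (h : ∀ i, adjoint (V i).toContinuousLinearMap z = adjoint (V i).toContinuousLinearMap w) :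
    z = w := by
  rw [← sub_eq_zero, ← norm_le_zero_iff]
  simpa using hV.norm_le_of_component_le (z := z - w) (w := 0) zero_le_one fun i => by
    simp [h i]

/-- A family of operators that acts on the `j`-th summand of a Hilbert sum by the scalar
`e ^ (-a σ j)` satisfies the continuity conditions. -/
theorem isContinuousFamily_of_isHilbertSum (hV : IsHilbertSum ℂ G V) (σ : I → ℝ)
    {P : PosReal → A →L[ℂ] A} (hP : ∀ a i x, P a (V i x) = decay (σ i) a • V i x) :
    IsContinuousFamily P := by
  have happly : ∀ (t : ℝ≥0) i x, extendZero P t (V i x) =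
      ((Real.exp (-((t : ℝ) * σ i)) : ℝ) : ℂ) • V i x := by
    intro t i x
    by_cases ht : 0 < (t : ℝ)
    · simp only [extendZero, ht, dite_true, hP]; rfl
    · have h0 : (t : ℝ) = 0 := le_antisymm (not_lt.mp ht) t.2
      simp [extendZero, h0]
  have hcoord : ∀ (t : ℝ≥0) i z, adjoint (V i).toContinuousLinearMap (extendZero P t z) =
      ((Real.exp (-((t : ℝ) * σ i)) : ℝ) : ℂ) • adjoint (V i).toContinuousLinearMap z := by
    intro t i z
    exact hV.adjoint_apply_of_diagonal (happly t) i z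
  -- near `t`, the operator norm is at most `1` on the summands with `0 ≤ σ i`, and at most
  -- `‖P (t + 1)‖` on the others, whose decay factors increase with the parameter
  have hbdd : LocallyBdd (extendZero P) := by
    intro t
    set N : PosReal := ⟨t + 1, by positivity⟩
    refine ⟨max 1 ‖P N‖, ?_⟩
    filter_upwards [gt_mem_nhds (show t < t + 1 by simp)] with s hs
    refine ContinuousLinearMap.opNorm_le_bound _ (by positivity) fun z =>
      hV.norm_le_of_component_le (by positivity) fun i => ?_
    rw [hcoord, norm_smul, Complex.norm_real, Real.norm_of_nonneg (Real.exp_pos _).le]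
    set y := adjoint (V i).toContinuousLinearMap z
    obtain hy | hy := eq_or_ne y 0
    · simp [hy]
    refine mul_le_mul_of_nonneg_right ?_ (norm_nonneg y)
    obtain hσ | hσ := le_total 0 (σ i)
    · refine le_max_of_le_left (Real.exp_le_one_iff.2 ?_)
      have := mul_nonneg s.2 hσ
      change -((s : ℝ) * σ i) ≤ 0
      exact neg_nonpos.2 this
    -- a non-zero summand bounds its own decay factor at `N` by the norm of `P N`
    · refine le_max_of_le_right (le_trans ?_ ?_ (b := Real.exp (-(N * σ i))))
      · have hs' : (s : ℝ) ≤ N := by exact_mod_cast hs.le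
        exact Real.exp_le_exp.2 (neg_le_neg (mul_le_mul_of_nonpos_right hs' hσ))
      · have h1 := (P N).le_opNorm (V i y)
        rw [hP, norm_smul, LinearIsometry.norm_map, decay, Complex.norm_real,
          Real.norm_of_nonneg (Real.exp_pos _).le] at h1
        exact le_of_mul_le_mul_right h1 (norm_pos_iff.2 hy)
  have hcont : ∀ z, Continuous fun t => extendZero P t z := by
    refine isTotal_of_isHilbertSum hV _ (isClosed_contVectors hbdd) fun i x => ?_
    change Continuous fun t => extendZero P t (V i x)
    simp only [happly]
    fun_prop
  refine ⟨fun x => ?_, fun n z => ?_⟩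
  · have h2 := ((hcont x).tendsto 0).comp tendsto_atZero_coe
    rw [extendZero_zero] at h2
    exact h2.congr fun a => DFunLike.congr_fun (extendZero_coe P a) x
  · exact (continuous_tpowMap n (X := Fin (n + 1) → ℝ≥0)
      (T := fun i t => extendZero P (t i))
      (fun i t => (hbdd (t i)).imp fun C hC => (continuous_apply i).continuousAt.eventually hC)
      fun i z => (hcont z).comp (continuous_apply i)).2 z

end DiagonalFamily

/-! ### The axioms for a direct sum -/

section SumAxioms

variable {I : Type*} {B : I → RFA.{u}} {A : HilbSp.{u}} {ι : ∀ j, (B j).space →L[ℂ] A}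
  {μ : PosReal → HTensor A A →L[ℂ] A} {η : PosReal → ℂ →L[ℂ] A}
  {Δ : PosReal → A →L[ℂ] HTensor A A} {ε : PosReal → A →L[ℂ] ℂ}
  (hι : IsTotal ι)
  (hμ : ∀ a j, μ a ∘L tmap (ι j) (ι j) = ι j ∘L (B j).str.μ a)
  (hμ0 : ∀ a j k, j ≠ k → μ a ∘L tmap (ι j) (ι k) = 0)
  (hη : ∀ a, HasSum (fun j => ι j ((B j).str.η a 1)) (η a 1))
  (hΔ : ∀ a j, Δ a ∘L ι j = tmap (ι j) (ι j) ∘L (B j).str.Δ a)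
  (hε : ∀ a j, ε a ∘L ι j = (B j).str.ε a)

include hμ hμ0 hη in
theorem sum_mul_unit (a b : PosReal) (j : I) :
    (μ a ∘L tmap (.id ℂ A) (η b) ∘L runitInv) ∘L ι j =
      ι j ∘L (B j).str.μ a ∘L tmap (.id ℂ (B j).space) ((B j).str.η b) ∘L runitInv := by
  ext x
  have h1 := (hη b).mapL (μ a ∘L UniformSpace.Completion.toComplL ∘L
    TensorProduct.mkL ℂ A A (ι j x))
  have h2 := hasSum_single (f := fun k => μ a (tmul (ι j x) (ι k ((B k).str.η b 1)))) j
    fun k hk => by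
      have := DFunLike.congr_fun (hμ0 a j k hk.symm) (tmul x ((B k).str.η b 1))
      simpa [tmap_tmul] using this
  have h3 := DFunLike.congr_fun (hμ a j) (tmul x ((B j).str.η b 1))
  simp only [ContinuousLinearMap.comp_apply, tmap_tmul] at h3
  have h4 : μ a (tmul (ι j x) (η b 1)) = _ := h1.unique h2
  simp [runitInv_apply, tmap_tmul, h3, h4]

include hμ hμ0 hη in
theorem sum_unit_mul (a b : PosReal) (j : I) :
    (μ a ∘L tmap (η b) (.id ℂ A) ∘L lunitInv) ∘L ι j =
      ι j ∘L (B j).str.μ a ∘L tmap ((B j).str.η b) (.id ℂ (B j).space) ∘L lunitInv := by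
  ext x
  have h1 := (hη b).mapL (μ a ∘L UniformSpace.Completion.toComplL ∘L
    (TensorProduct.mkL ℂ A A).flip (ι j x))
  have h2 := hasSum_single (f := fun k => μ a (tmul (ι k ((B k).str.η b 1)) (ι j x))) j
    fun k hk => by
      have := DFunLike.congr_fun (hμ0 a k j hk) (tmul ((B k).str.η b 1) x)
      simpa [tmap_tmul] using this
  have h3 := DFunLike.congr_fun (hμ a j) (tmul ((B j).str.η b 1) x)
  simp only [ContinuousLinearMap.comp_apply, tmap_tmul] at h3
  have h4 : μ a (tmul (η b 1) (ι j x)) = _ := h1.unique h2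
  simp [lunitInv_apply, tmap_tmul, h3, h4]

include hι hμ hμ0 in
theorem sum_mul_assoc {a₁ a₂ b₁ b₂ : PosReal} (h : a₁ + a₂ = b₁ + b₂) :
    μ a₁ ∘L tmap (.id ℂ A) (μ a₂) ∘L assoc = μ b₁ ∘L tmap (μ b₂) (.id ℂ A) := by
  refine ((hι.tmap hι).tmap hι).ext ?_
  rintro ⟨⟨j, k⟩, l⟩
  change _ ∘L tmap (tmap (ι j) (ι k)) (ι l) = _ ∘L tmap (tmap (ι j) (ι k)) (ι l)
  by_cases hjk : j = k
  · by_cases hkl : k = l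
    · subst hjk hkl
      rw [intertwine_mul_right (hμ a₁ j) (hμ a₂ j), intertwine_mul_left (hμ b₁ j) (hμ b₂ j),
        (B j).str.mul_assoc a₁ a₂ b₁ b₂ h]
    · subst hjk
      refine ext_tmul_left fun x y z => ?_
      have h1 := DFunLike.congr_fun (hμ0 a₂ j l hkl) (tmul y z)
      have h2 := DFunLike.congr_fun (hμ b₂ j) (tmul x y)
      have h3 := DFunLike.congr_fun (hμ0 b₁ j l hkl) (tmul ((B j).str.μ b₂ (tmul x y)) z)
      simp only [ContinuousLinearMap.comp_apply, tmap_tmul, zero_apply]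
        at h1 h2 h3
      simp [tmap_tmul, assoc_tmul, h1, h2, h3, tmul_zero]
  · refine ext_tmul_left fun x y z => ?_
    have h2 := DFunLike.congr_fun (hμ0 b₂ j k hjk) (tmul x y)
    by_cases hkl : k = l
    · subst hkl
      have h1 := DFunLike.congr_fun (hμ a₂ k) (tmul y z)
      have h3 := DFunLike.congr_fun (hμ0 a₁ j k hjk) (tmul x ((B k).str.μ a₂ (tmul y z)))
      simp only [ContinuousLinearMap.comp_apply, tmap_tmul, zero_apply]
        at h1 h2 h3
      simp [tmap_tmul, assoc_tmul, h1, h2, h3, zero_tmul]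
    · have h1 := DFunLike.congr_fun (hμ0 a₂ k l hkl) (tmul y z)
      simp only [ContinuousLinearMap.comp_apply, tmap_tmul, zero_apply]
        at h1 h2
      simp [tmap_tmul, assoc_tmul, h1, h2, zero_tmul, tmul_zero]

include hι hμ hμ0 hΔ in
theorem sum_frobenius_left {a₁ a₂ c₁ c₂ : PosReal} (h : a₁ + a₂ = c₁ + c₂) :
    tmap (.id ℂ A) (μ a₁) ∘L assoc ∘L tmap (Δ a₂) (.id ℂ A) = Δ c₁ ∘L μ c₂ := by
  refine (hι.tmap hι).ext ?_
  rintro ⟨j, k⟩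
  dsimp only
  by_cases hjk : j = k
  · subst hjk
    rw [intertwine_frobenius_left (hμ a₁ j) (hΔ a₂ j), (B j).str.frobenius_left a₁ a₂ c₁ c₂ h,
      ContinuousLinearMap.comp_assoc, hμ, ← ContinuousLinearMap.comp_assoc (Δ c₁), hΔ]
    rfl
  · have h1 : tmap (Δ a₂) (.id ℂ A) ∘L tmap (ι j) (ι k) =
        tmap (tmap (ι j) (ι j)) (ι k) ∘L tmap ((B j).str.Δ a₂) (.id ℂ _) := by
      rw [← tmap_comp, ← tmap_comp, hΔ]
      rfl
    have h2 : tmap (.id ℂ A) (μ a₁) ∘L tmap (ι j) (tmap (ι j) (ι k)) = 0 := by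
      rw [← tmap_comp, hμ0 a₁ j k hjk, tmap_zero_right]
    rw [ContinuousLinearMap.comp_assoc, ContinuousLinearMap.comp_assoc, h1,
      ← ContinuousLinearMap.comp_assoc assoc, assoc_comp_tmap, ContinuousLinearMap.comp_assoc,
      ← ContinuousLinearMap.comp_assoc, h2, ContinuousLinearMap.zero_comp,
      ContinuousLinearMap.comp_assoc, hμ0 c₂ j k hjk, ContinuousLinearMap.comp_zero]

include hι hμ hμ0 hΔ in
theorem sum_frobenius_right {b₁ b₂ c₁ c₂ : PosReal} (h : b₁ + b₂ = c₁ + c₂) :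
    tmap (μ b₁) (.id ℂ A) ∘L assocInv ∘L tmap (.id ℂ A) (Δ b₂) = Δ c₁ ∘L μ c₂ := by
  refine (hι.tmap hι).ext ?_
  rintro ⟨j, k⟩
  dsimp only
  by_cases hjk : j = k
  · subst hjk
    rw [intertwine_frobenius_right (hμ b₁ j) (hΔ b₂ j), (B j).str.frobenius_right b₁ b₂ c₁ c₂ h,
      ContinuousLinearMap.comp_assoc, hμ, ← ContinuousLinearMap.comp_assoc (Δ c₁), hΔ]
    rfl
  · have h1 : tmap (.id ℂ A) (Δ b₂) ∘L tmap (ι j) (ι k) =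
        tmap (ι j) (tmap (ι k) (ι k)) ∘L tmap (.id ℂ _) ((B k).str.Δ b₂) := by
      rw [← tmap_comp, ← tmap_comp, hΔ]
      rfl
    have h2 : tmap (μ b₁) (.id ℂ A) ∘L tmap (tmap (ι j) (ι k)) (ι k) = 0 := by
      rw [← tmap_comp, hμ0 b₁ j k hjk, tmap_zero_left]
    rw [ContinuousLinearMap.comp_assoc, ContinuousLinearMap.comp_assoc, h1,
      ← ContinuousLinearMap.comp_assoc assocInv, assocInv_comp_tmap,
      ContinuousLinearMap.comp_assoc,
      ← ContinuousLinearMap.comp_assoc, h2, ContinuousLinearMap.zero_comp,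
      ContinuousLinearMap.comp_assoc, hμ0 c₂ j k hjk, ContinuousLinearMap.comp_zero]

/-- The RFA structure on `A` determined by RFA structures on the members of a total family of
subspaces whose mutual products vanish. -/
def sumFrobenius
    (hP : IsContinuousFamily fun a : PosReal =>
      μ (half a) ∘L tmap (.id ℂ A) (η (half a)) ∘L runitInv)
    (hP' : IsContinuousFamily fun a : PosReal =>
      runit ∘L tmap (.id ℂ A) (ε (half a)) ∘L Δ (half a)) : RegFrobenius A where
  μ := μ
  η := η
  Δ := Δ
  ε := ε
  unit a₁ a₂ b₁ b₂ h := hι.ext fun j => by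
    rw [sum_mul_unit hμ hμ0 hη, sum_unit_mul hμ hμ0 hη, (B j).str.unit a₁ a₂ b₁ b₂ h]
  mul_assoc a₁ a₂ b₁ b₂ h := sum_mul_assoc hι hμ hμ0 h
  continuous_family := hP
  counit a₁ a₂ b₁ b₂ h := hι.ext fun j => by
    rw [intertwine_counit_right (hΔ a₁ j) (hε a₂ j), intertwine_counit_left (hΔ b₁ j) (hε b₂ j),
      (B j).str.counit a₁ a₂ b₁ b₂ h]
  comul_assoc a₁ a₂ b₁ b₂ h := hι.ext fun j => by
    rw [intertwine_comul_right (hΔ a₂ j) (hΔ a₁ j), intertwine_comul_left (hΔ b₂ j) (hΔ b₁ j),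
      (B j).str.comul_assoc a₁ a₂ b₁ b₂ h]
  cocontinuous_family := hP'
  frobenius_left a₁ a₂ c₁ c₂ h := sum_frobenius_left hι hμ hμ0 hΔ h
  frobenius_right b₁ b₂ c₁ c₂ h := sum_frobenius_right hι hμ hμ0 hΔ h

end SumAxioms

/-! ### Morphisms between direct sums -/

theorem norm_decay (σ : ℝ) (a : PosReal) : ‖decay σ a‖ = Real.exp (-(a * σ)) := by
  rw [decay, Complex.norm_real, Real.norm_of_nonneg (Real.exp_pos _).le]

theorem decay_ne_zero (σ : ℝ) (a : PosReal) : decay σ a ≠ 0 := by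
  rw [← norm_ne_zero_iff, norm_decay]
  exact (Real.exp_pos _).ne'

theorem Frobenius.regularise_mul_unit {A : HilbSp.{u}} (S : Frobenius A) (σ : ℝ) (a b : PosReal) :
    (S.regularise σ).μ a ∘L tmap (.id ℂ A) ((S.regularise σ).η b) ∘L runitInv =
      decay σ (a + b) • .id ℂ A := by
  simp only [Frobenius.regularise, tmap_smul_right, ContinuousLinearMap.smul_comp,
    ContinuousLinearMap.comp_smul, smul_smul, decay_mul, S.mul_unit]
  rw [add_comm]

theorem Frobenius.regularise_comul_counit {A : HilbSp.{u}} (S : Frobenius A) (σ : ℝ)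
    (a b : PosReal) :
    runit ∘L tmap (.id ℂ A) ((S.regularise σ).ε b) ∘L (S.regularise σ).Δ a =
      decay σ (a + b) • .id ℂ A := by
  simp only [Frobenius.regularise, tmap_smul_right, ContinuousLinearMap.smul_comp,
    ContinuousLinearMap.comp_smul, smul_smul, decay_mul, S.comul_counit]

section SumHom

variable {I I' : Type} {B : I → RFA.{u}} {A : RFA.{u}} {ι : ∀ j, (B j).space →ₗᵢ[ℂ] A.space}
  {B' : I' → RFA.{u}} {A' : RFA.{u}} {ι' : ∀ j, (B' j).space →ₗᵢ[ℂ] A'.space}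

/-- A bounded operator between Hilbert direct sums of RFAs that restricts to morphisms between
the summands, matched by a bijection, is a morphism of RFAs. -/
def RFAHom.ofIsHilbertDirectSum (h : IsHilbertDirectSum B A ι) (h' : IsHilbertDirectSum B' A' ι')
    (f : I ≃ I') (ψ : ∀ j, RFAHom (B j) (B' (f j))) (φ : A.space →L[ℂ] A'.space)
    (hφ : ∀ j x, φ (ι j x) = ι' (f j) ((ψ j).map x)) : RFAHom A A' where
  map := φ
  map_mul a := by
    have htot := isTotal_of_isHilbertSum h.isHilbertSum
    refine (htot.tmap htot).ext ?_
    rintro ⟨j, k⟩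
    refine ext_tmul fun x y => ?_
    simp only [ContinuousLinearMap.comp_apply, tmap_tmul, LinearIsometry.coe_toContinuousLinearMap,
      hφ]
    by_cases hjk : j = k
    · subst hjk
      have := DFunLike.congr_fun ((ψ j).map_mul a) (tmul x y)
      simp only [ContinuousLinearMap.comp_apply, tmap_tmul] at this
      rw [h.mul_same, h'.mul_same, hφ, this]
    · rw [h.mul_ne a j k hjk, h'.mul_ne a _ _ (f.injective.ne hjk), map_zero]
  map_unit a := by
    refine ContinuousLinearMap.ext_ring ?_
    have h1 := (h.unit a).mapL φ
    have h2 := f.hasSum_iff.2 (h'.unit a)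
    have h3 : (fun j => φ (ι j ((B j).str.η a 1))) =
        (fun k => ι' k ((B' k).str.η a 1)) ∘ f := by
      funext j
      have := DFunLike.congr_fun ((ψ j).map_unit a) 1
      rw [ContinuousLinearMap.comp_apply] at this
      rw [hφ, this]
      rfl
    rw [← h3] at h2
    exact h1.unique h2
  map_comul a := by
    refine (isTotal_of_isHilbertSum h.isHilbertSum).ext fun j => ?_
    have h1 : φ ∘L (ι j).toContinuousLinearMap =
      (ι' (f j)).toContinuousLinearMap ∘L (ψ j).map := ContinuousLinearMap.ext fun x => hφ j x
    ext x
    have h2 := DFunLike.congr_fun ((ψ j).map_comul a) x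
    simp only [ContinuousLinearMap.comp_apply, LinearIsometry.coe_toContinuousLinearMap] at h2 ⊢
    rw [h.comul, hφ, h'.comul, ← h2, ← ContinuousLinearMap.comp_apply, ← tmap_comp, h1, tmap_comp]
    rfl
  map_counit a := by
    refine (isTotal_of_isHilbertSum h.isHilbertSum).ext fun j => ?_
    ext x
    have h2 := DFunLike.congr_fun ((ψ j).map_counit a) x
    simp only [ContinuousLinearMap.comp_apply, LinearIsometry.coe_toContinuousLinearMap] at h2 ⊢
    rw [hφ, h'.counit, h.counit, h2]

end SumHom

/-- A morphism of Frobenius algebras is a morphism of the RFAs with the same `σ`. -/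
def IsFrobeniusHom.toRFAHom {A B : HilbSp.{u}} {S : Frobenius A} {T : Frobenius B}
    {φ : A →L[ℂ] B} (h : IsFrobeniusHom S T φ) {σ τ : ℝ} (hσ : σ = τ) :
    RFAHom ⟨A, S.regularise σ⟩ ⟨B, T.regularise τ⟩ where
  map := φ
  map_mul a := by
    simp only [Frobenius.regularise, ContinuousLinearMap.comp_smul, ContinuousLinearMap.smul_comp,
      h.map_mul, hσ]
  map_unit a := by
    simp only [Frobenius.regularise, ContinuousLinearMap.comp_smul, h.map_unit, hσ]
  map_comul a := by
    simp only [Frobenius.regularise, ContinuousLinearMap.comp_smul, ContinuousLinearMap.smul_comp,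
      h.map_comul, hσ]
  map_counit a := by
    simp only [Frobenius.regularise, ContinuousLinearMap.smul_comp, h.map_counit, hσ]

/-! ### The direct sum functor -/

namespace FrobFamily

variable (Φ : FrobFamily.{u})

/-- The Hilbert direct sum of the members of a family. -/
abbrev sumSpace : HilbSp.{u} := ⟨lp (fun j => (Φ.F j : Type u)) 2⟩

open scoped Classical in
/-- The inclusion of the `j`-th member into the Hilbert direct sum. -/
def incl (j : Φ.I) : Φ.F j →ₗᵢ[ℂ] Φ.sumSpace where
  toLinearMap := lp.lsingle (𝕜 := ℂ) (E := fun j => (Φ.F j : Type u)) 2 j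
  norm_map' x := lp.norm_single (E := fun j => (Φ.F j : Type u)) (by norm_num) j x

theorem isHilbertSum_incl : IsHilbertSum ℂ (fun j => (Φ.F j : Type u)) Φ.incl := by
  classical
  have hO : OrthogonalFamily ℂ (fun j => (Φ.F j : Type u)) Φ.incl := by
    intro i j hij x y
    have := lp.inner_single_left (𝕜 := ℂ) (G := fun j => (Φ.F j : Type u)) i x
      (lp.single 2 j y)
    rw [lp.single_apply_ne _ _ _ hij, inner_zero_right] at this
    exact this
  refine ⟨hO, fun w => ⟨w, (hO.hasSum_linearIsometry w).unique ?_⟩⟩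
  have := lp.hasSum_single (E := fun j => (Φ.F j : Type u)) (p := 2) (by norm_num) w
  exact this

theorem orthogonalFamily_incl : OrthogonalFamily ℂ (fun j => (Φ.F j : Type u)) Φ.incl :=
  Φ.isHilbertSum_incl.OrthogonalFamily

theorem isTotal_incl : IsTotal fun j => (Φ.incl j).toContinuousLinearMap :=
  isTotal_of_isHilbertSum Φ.isHilbertSum_incl

/-- The bound `sup_j e ^ (-a σ j) ‖μ j‖ < ∞`, which makes the product of the sum bounded. -/
theorem exists_norm_mul_le (a : PosReal) : ∃ C : ℝ, ∀ j, ‖decay (Φ.σ j) a • (Φ.frob j).μ‖ ≤ C := by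
  obtain ⟨C, hC⟩ := Φ.bddAbove_mul a a.2
  refine ⟨C, fun j => ?_⟩
  refine le_trans (ContinuousLinearMap.opNorm_le_bound _ (by positivity) fun z => ?_)
    (hC ⟨j, rfl⟩)
  rw [smul_apply, norm_smul, norm_decay, mul_assoc]
  gcongr
  exact (Φ.frob j).μ.le_opNorm z

/-- The product of the direct sum. -/
def sumMul (a : PosReal) : HTensor Φ.sumSpace Φ.sumSpace →L[ℂ] Φ.sumSpace :=
  orthoSum Φ.orthogonalFamily_incl.tmapIsometry Φ.orthogonalFamily_incl
    (fun j => decay (Φ.σ j) a • (Φ.frob j).μ) _ (Φ.exists_norm_mul_le a).choose_spec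

/-- The components of the unit are square-summable, since `∑_j e ^ (-2 a σ j) ‖η j‖ ^ 2 < ∞`. -/
theorem memℓp_unit (a : PosReal) :
    Memℓp (fun j => decay (Φ.σ j) a • (Φ.frob j).η 1) 2 := by
  refine memℓp_gen ?_
  refine (Φ.summable_unit a a.2).of_nonneg_of_le (fun j => by positivity) fun j => ?_
  have h1 := (Φ.frob j).η.le_opNorm 1
  rw [norm_one, mul_one] at h1
  have h2 : Real.exp (-(2 * a * Φ.σ j)) = Real.exp (-(a * Φ.σ j)) ^ 2 := by
    rw [← Real.exp_nat_mul]
    congr 1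
    push_cast
    ring
  simp only [ENNReal.toReal_ofNat, Real.rpow_ofNat]
  rw [norm_smul, norm_decay, mul_pow, h2]
  gcongr

/-- The unit vector of the direct sum, with components `e ^ (-a σ j) η j`. -/
def unitVector (a : PosReal) : Φ.sumSpace :=
  (⟨_, Φ.memℓp_unit a⟩ : lp (fun j => (Φ.F j : Type u)) 2)

/-- The unit of the direct sum. -/
def sumUnit (a : PosReal) : ℂ →L[ℂ] Φ.sumSpace :=
  ContinuousLinearMap.toSpanSingleton ℂ (Φ.unitVector a)

theorem sumMul_comp_same (a : PosReal) (j : Φ.I) :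
    Φ.sumMul a ∘L tmap (Φ.incl j).toContinuousLinearMap (Φ.incl j).toContinuousLinearMap =
      (Φ.incl j).toContinuousLinearMap ∘L (decay (Φ.σ j) a • (Φ.frob j).μ) := by
  refine ContinuousLinearMap.ext fun z => ?_
  exact orthoSum_apply Φ.orthogonalFamily_incl.tmapIsometry Φ.orthogonalFamily_incl
    (fun j => decay (Φ.σ j) a • (Φ.frob j).μ) _ (Φ.exists_norm_mul_le a).choose_spec j z

theorem sumMul_comp_ne (a : PosReal) {j k : Φ.I} (h : j ≠ k) :
    Φ.sumMul a ∘L tmap (Φ.incl j).toContinuousLinearMap (Φ.incl k).toContinuousLinearMap = 0 := by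
  refine ext_tmul fun x y => ?_
  rw [ContinuousLinearMap.comp_apply, tmap_tmul]
  refine orthoSum_eq_zero Φ.orthogonalFamily_incl.tmapIsometry Φ.orthogonalFamily_incl _ _
    (Φ.exists_norm_mul_le a).choose_spec fun l => ?_
  change adjoint (tmap (Φ.incl l).toContinuousLinearMap (Φ.incl l).toContinuousLinearMap) _ = 0
  rw [adjoint_tmap, tmap_tmul]
  obtain rfl | hl := eq_or_ne l j
  · have := Φ.orthogonalFamily_incl.adjoint_apply_of_ne h y
    exact (congrArg _ this).trans (tmul_zero _)
  · have := Φ.orthogonalFamily_incl.adjoint_apply_of_ne hl x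
    exact (congrArg (fun z => tmul z _) this).trans (zero_tmul _)

theorem adjoint_sumMul_comp (a : PosReal) (j : Φ.I) :
    adjoint (Φ.sumMul a) ∘L (Φ.incl j).toContinuousLinearMap =
      tmap (Φ.incl j).toContinuousLinearMap (Φ.incl j).toContinuousLinearMap ∘L
        (decay (Φ.σ j) a • (Φ.frob j).Δ) := by
  ext z
  have h1 : adjoint (decay (Φ.σ j) a • (Φ.frob j).μ) = decay (Φ.σ j) a • (Φ.frob j).Δ :=
    ((Φ.summand j).property a).1
  rw [sumMul, adjoint_orthoSum, ← h1]
  exact orthoSum_apply Φ.orthogonalFamily_incl Φ.orthogonalFamily_incl.tmapIsometry _ _ _ j z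

theorem hasSum_sumUnit (a : PosReal) :
    HasSum (fun j => Φ.incl j (decay (Φ.σ j) a • (Φ.frob j).η 1)) (Φ.sumUnit a 1) := by
  classical
  have h := lp.hasSum_single (E := fun j => (Φ.F j : Type u)) (p := 2) (by norm_num)
    (Φ.unitVector a)
  rw [sumUnit, ContinuousLinearMap.toSpanSingleton_apply, one_smul]
  exact h

theorem adjoint_sumUnit_comp (a : PosReal) (j : Φ.I) :
    adjoint (Φ.sumUnit a) ∘L (Φ.incl j).toContinuousLinearMap =
      decay (Φ.σ j) a • (Φ.frob j).ε := by
  classical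
  have h1 : adjoint (decay (Φ.σ j) a • (Φ.frob j).η) = decay (Φ.σ j) a • (Φ.frob j).ε :=
    ((Φ.summand j).property a).2
  rw [← h1]
  ext x
  refine ext_inner_left ℂ fun c => ?_
  rw [ContinuousLinearMap.comp_apply, ContinuousLinearMap.adjoint_inner_right,
    ContinuousLinearMap.adjoint_inner_right, sumUnit, ContinuousLinearMap.toSpanSingleton_apply]
  have h2 := lp.inner_single_right (𝕜 := ℂ) (G := fun j => (Φ.F j : Type u)) j x
    (c • Φ.unitVector a)
  have h3 : (decay (Φ.σ j) a • (Φ.frob j).η) c = c • decay (Φ.σ j) a • (Φ.frob j).η 1 := by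
    rw [smul_apply, smul_comm, ← map_smul _ c, smul_eq_mul, mul_one]
  rw [h3]
  exact h2

theorem sum_mul_unit_apply (a b : PosReal) (j : Φ.I) (x : Φ.F j) :
    (Φ.sumMul a ∘L tmap (.id ℂ Φ.sumSpace) (Φ.sumUnit b) ∘L runitInv) (Φ.incl j x) =
      decay (Φ.σ j) (a + b) • Φ.incl j x := by
  have h := DFunLike.congr_fun (sum_mul_unit (B := fun j => (Φ.summand j).obj)
    (ι := fun j => (Φ.incl j).toContinuousLinearMap) Φ.sumMul_comp_same
    (fun a j k => Φ.sumMul_comp_ne a) Φ.hasSum_sumUnit a b j) x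
  have h2 := DFunLike.congr_fun ((Φ.frob j).toFrobenius.regularise_mul_unit (Φ.σ j) a b) x
  refine h.trans ((congrArg (Φ.incl j) h2).trans ?_)
  exact map_smul (Φ.incl j) _ _

theorem sum_comul_counit_apply (a b : PosReal) (j : Φ.I) (x : Φ.F j) :
    (runit ∘L tmap (.id ℂ Φ.sumSpace) (adjoint (Φ.sumUnit b)) ∘L adjoint (Φ.sumMul a))
      (Φ.incl j x) = decay (Φ.σ j) (a + b) • Φ.incl j x := by
  have h := DFunLike.congr_fun (intertwine_counit_right (Φ.adjoint_sumMul_comp a j)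
    (Φ.adjoint_sumUnit_comp b j)) x
  have h2 := DFunLike.congr_fun ((Φ.frob j).toFrobenius.regularise_comul_counit (Φ.σ j) a b) x
  refine h.trans ((congrArg (Φ.incl j) h2).trans ?_)
  exact map_smul (Φ.incl j) _ _

/-- The Hilbert direct sum of a family, as a Hermitian RFA. -/
abbrev directSum : DaggerRFA.{u} where
  obj := ⟨Φ.sumSpace, sumFrobenius (B := fun j => (Φ.summand j).obj)
    (ι := fun j => (Φ.incl j).toContinuousLinearMap)
    (Δ := fun a => adjoint (Φ.sumMul a)) (ε := fun a => adjoint (Φ.sumUnit a))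
    Φ.isTotal_incl Φ.sumMul_comp_same (fun a j k => Φ.sumMul_comp_ne a) Φ.hasSum_sumUnit
    Φ.adjoint_sumMul_comp Φ.adjoint_sumUnit_comp
    (isContinuousFamily_of_isHilbertSum Φ.isHilbertSum_incl Φ.σ fun a j x => by
      rw [sum_mul_unit_apply, half_add_half])
    (isContinuousFamily_of_isHilbertSum Φ.isHilbertSum_incl Φ.σ fun a j x => by
      rw [sum_comul_counit_apply, half_add_half])⟩
  property a := ⟨rfl, rfl⟩

theorem isHilbertDirectSum_directSum :
    IsHilbertDirectSum (fun j => (Φ.summand j).obj) Φ.directSum.obj Φ.incl where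
  isHilbertSum := Φ.isHilbertSum_incl
  mul_same := fun a j (x y : Φ.F j) => by
    have := DFunLike.congr_fun (Φ.sumMul_comp_same a j) (tmul x y)
    rw [ContinuousLinearMap.comp_apply, tmap_tmul] at this
    exact this
  mul_ne := fun a j k h (x : Φ.F j) (y : Φ.F k) => by
    have := DFunLike.congr_fun (Φ.sumMul_comp_ne a h) (tmul x y)
    rw [ContinuousLinearMap.comp_apply, tmap_tmul] at this
    exact this
  unit := Φ.hasSum_sumUnit
  comul a j x := DFunLike.congr_fun (Φ.adjoint_sumMul_comp a j) x
  counit a j x := DFunLike.congr_fun (Φ.adjoint_sumUnit_comp a j) x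

variable {Φ} {Φ' Φ'' : FrobFamily.{u}}

/-- The direct sum `⨁ ψ j` of the operators of a morphism of families. -/
def sumMap (Ψ : Φ ⟶ Φ') : Φ.sumSpace →L[ℂ] Φ'.sumSpace :=
  orthoSum Φ.orthogonalFamily_incl (Φ'.orthogonalFamily_incl.comp Ψ.f.injective) Ψ.ψ _
    Ψ.bounded.choose_spec

theorem sumMap_incl (Ψ : Φ ⟶ Φ') (j : Φ.I) (x : Φ.F j) :
    sumMap Ψ (Φ.incl j x) = Φ'.incl (Ψ.f j) (Ψ.ψ j x) :=
  orthoSum_apply Φ.orthogonalFamily_incl (Φ'.orthogonalFamily_incl.comp Ψ.f.injective) Ψ.ψ _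
    Ψ.bounded.choose_spec j x

/-- The morphism of RFAs `⨁ ψ j`. -/
def directSumMap (Ψ : Φ ⟶ Φ') : Φ.directSum ⟶ Φ'.directSum :=
  ⟨RFAHom.ofIsHilbertDirectSum Φ.isHilbertDirectSum_directSum Φ'.isHilbertDirectSum_directSum Ψ.f
    (fun j => (Ψ.isHom j).toRFAHom (Ψ.σ_eq j)) (sumMap Ψ) (sumMap_incl Ψ)⟩

theorem hom_ext_incl {A : DaggerRFA.{u}} {p q : Φ.directSum ⟶ A}
    (h : ∀ j (x : Φ.F j), p.hom.map (Φ.incl j x) = q.hom.map (Φ.incl j x)) : p = q := by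
  refine ObjectProperty.hom_ext _ (RFAHom.ext (Φ.isTotal_incl.ext fun j => ?_))
  ext x
  exact h j x

end FrobFamily

/-- The direct sum functor from families of `†`-Frobenius algebras to Hermitian RFAs. -/
def directSumFunctor : FrobFamily.{u} ⥤ DaggerRFA.{u} where
  obj Φ := Φ.directSum
  map Ψ := FrobFamily.directSumMap Ψ
  map_id Φ := FrobFamily.hom_ext_incl fun j x => FrobFamily.sumMap_incl (𝟙 Φ) j x
  map_comp Ψ Ψ' := FrobFamily.hom_ext_incl fun j x => by
    refine (FrobFamily.sumMap_incl (Ψ ≫ Ψ') j x).trans ?_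
    change _ = FrobFamily.sumMap Ψ' (FrobFamily.sumMap Ψ _)
    rw [FrobFamily.sumMap_incl, FrobFamily.sumMap_incl]
    rfl

/-! ### Morphisms between direct sums of reduced families -/

theorem Frobenius.unit_ne_zero {A : HilbSp.{u}} [Nontrivial A] (S : Frobenius A) :
    S.η 1 ≠ 0 := by
  intro h
  obtain ⟨x, hx⟩ := exists_ne (0 : A)
  have := DFunLike.congr_fun S.mul_unit x
  simp only [ContinuousLinearMap.comp_apply, runitInv_apply, tmap_tmul, h, tmul_zero, map_zero]
    at this
  exact hx this.symm

theorem Frobenius.counit_ne_zero {A : HilbSp.{u}} [Nontrivial A] (S : Frobenius A) : S.ε ≠ 0 := by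
  intro h
  obtain ⟨x, hx⟩ := exists_ne (0 : A)
  have := DFunLike.congr_fun S.comul_counit x
  simp only [h, tmap_zero_right, ContinuousLinearMap.zero_comp, ContinuousLinearMap.comp_zero]
    at this
  exact hx this.symm

theorem decay_injective {σ τ : ℝ} (a : PosReal) (h : decay σ a = decay τ a) : σ = τ := by
  have h1 : Real.exp (-(a * σ)) = Real.exp (-(a * τ)) := Complex.ofReal_injective h
  have h2 := Real.exp_injective h1
  exact mul_left_cancel₀ a.2.ne' (neg_injective h2)

/-- A morphism of RFAs commutes with the operators `P = μ ∘ (id ⊗ η)`. -/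
theorem RFAHom.map_mul_unit {A B : RFA.{u}} (p : RFAHom A B) (a b : PosReal) (x : A.space) :
    p.map ((A.str.μ a ∘L tmap (.id ℂ A.space) (A.str.η b) ∘L runitInv) x) =
      (B.str.μ a ∘L tmap (.id ℂ B.space) (B.str.η b) ∘L runitInv) (p.map x) := by
  have h1 := DFunLike.congr_fun (p.map_mul a) (tmul x (A.str.η b 1))
  have h2 := DFunLike.congr_fun (p.map_unit b) 1
  simp only [ContinuousLinearMap.comp_apply, tmap_tmul] at h1 h2
  simp [runitInv_apply, tmap_tmul, h1, h2]

namespace FrobFamily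

variable {Φ Φ' : FrobFamily.{u}}

theorem directSum_mul (a : PosReal) (j : Φ.I) (x y : Φ.F j) :
    Φ.directSum.obj.str.μ a (tmul (Φ.incl j x) (Φ.incl j y)) =
      Φ.incl j (decay (Φ.σ j) a • (Φ.frob j).μ (tmul x y)) :=
  Φ.isHilbertDirectSum_directSum.mul_same a j x y

theorem directSum_unit (a : PosReal) :
    HasSum (fun j => Φ.incl j (decay (Φ.σ j) a • (Φ.frob j).η 1)) (Φ.directSum.obj.str.η a 1) :=
  Φ.hasSum_sumUnit a

theorem directSum_comul (a : PosReal) (j : Φ.I) (x : Φ.F j) :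
    Φ.directSum.obj.str.Δ a (Φ.incl j x) = tmap (Φ.incl j).toContinuousLinearMap
      (Φ.incl j).toContinuousLinearMap (decay (Φ.σ j) a • (Φ.frob j).Δ x) :=
  Φ.isHilbertDirectSum_directSum.comul a j x

theorem directSum_counit (a : PosReal) (j : Φ.I) (x : Φ.F j) :
    Φ.directSum.obj.str.ε a (Φ.incl j x) = decay (Φ.σ j) a • (Φ.frob j).ε x :=
  Φ.isHilbertDirectSum_directSum.counit a j x

theorem directSum_mul_unit (a b : PosReal) (j : Φ.I) (x : Φ.F j) :
    (Φ.directSum.obj.str.μ a ∘L tmap (.id ℂ Φ.directSum.obj.space) (Φ.directSum.obj.str.η b) ∘L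
      runitInv) (Φ.incl j x) = decay (Φ.σ j) (a + b) • Φ.incl j x :=
  Φ.sum_mul_unit_apply a b j x

theorem adjoint_incl_unit (a : PosReal) (j : Φ.I) :
    adjoint (Φ.incl j).toContinuousLinearMap (Φ.directSum.obj.str.η a 1) =
      decay (Φ.σ j) a • (Φ.frob j).η 1 := by
  have h1 := (Φ.directSum_unit a).mapL (adjoint (Φ.incl j).toContinuousLinearMap)
  refine h1.unique ?_
  have h2 := hasSum_single (f := fun k => adjoint (Φ.incl j).toContinuousLinearMap
    (Φ.incl k (decay (Φ.σ k) a • (Φ.frob k).η 1))) j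
    fun k hk => Φ.orthogonalFamily_incl.adjoint_apply_of_ne hk.symm _
  rwa [adjoint_apply_self] at h2

variable (p : Φ.directSum ⟶ Φ'.directSum)

/-- The component of a morphism between direct sums that maps the `j`-th summand of the source to
the `k`-th summand of the target. -/
def component (j : Φ.I) (k : Φ'.I) : Φ.F j →L[ℂ] Φ'.F k :=
  adjoint (Φ'.incl k).toContinuousLinearMap ∘L p.hom.map ∘L (Φ.incl j).toContinuousLinearMap

theorem component_apply (j : Φ.I) (k : Φ'.I) (x : Φ.F j) : component p j k x =
    adjoint (Φ'.incl k).toContinuousLinearMap (p.hom.map (Φ.incl j x)) := rfl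

/-- Comparing the action of `P` on both sides, a component between summands with different `σ`
vanishes. -/
theorem component_eq_zero {j : Φ.I} {k : Φ'.I} (h : Φ.σ j ≠ Φ'.σ k) : component p j k = 0 := by
  ext x
  have a : PosReal := ⟨1, one_pos⟩
  have h1 := p.hom.map_mul_unit a a (Φ.incl j x)
  have h2 := Φ'.isHilbertSum_incl.adjoint_apply_of_diagonal
    (Φ'.directSum_mul_unit a a) k (p.hom.map (Φ.incl j x))
  have h3 : decay (Φ.σ j) (a + a) • component p j k x =
      decay (Φ'.σ k) (a + a) • component p j k x := by
    rw [← map_smul (component p j k), component_apply, map_smul (Φ.incl j),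
      ← Φ.directSum_mul_unit a a j x, h1]
    exact h2
  by_contra hne
  exact h (decay_injective (a + a) (smul_left_injective ℂ hne h3))

include p in
/-- Otherwise all components on `F j` vanish, and so does the counit of `F j`. -/
theorem exists_σ_eq_of_source (j : Φ.I) [Nontrivial (Φ.F j)] : ∃ k, Φ.σ j = Φ'.σ k := by
  by_contra! hne
  have h0 : ∀ x : Φ.F j, p.hom.map (Φ.incl j x) = 0 := fun x =>
    Φ'.isHilbertSum_incl.eq_of_component_eq fun k => by
      rw [map_zero]
      exact DFunLike.congr_fun (component_eq_zero p (hne k)) x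
  refine (Φ.frob j).toFrobenius.counit_ne_zero ?_
  ext x
  have a : PosReal := ⟨1, one_pos⟩
  have h1 := DFunLike.congr_fun (p.hom.map_counit a) (Φ.incl j x)
  rw [ContinuousLinearMap.comp_apply, h0, map_zero, directSum_counit] at h1
  exact (smul_eq_zero.1 h1.symm).resolve_left (decay_ne_zero _ _)

theorem hasSum_component_unit (a : PosReal) (k : Φ'.I) :
    HasSum (fun j => component p j k (decay (Φ.σ j) a • (Φ.frob j).η 1))
      (decay (Φ'.σ k) a • (Φ'.frob k).η 1) := by
  have h1 := (Φ.directSum_unit a).mapL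
    (adjoint (Φ'.incl k).toContinuousLinearMap ∘L p.hom.map)
  have h2 := DFunLike.congr_fun (p.hom.map_unit a) 1
  rw [ContinuousLinearMap.comp_apply] at h2
  rw [ContinuousLinearMap.comp_apply, h2, adjoint_incl_unit] at h1
  exact h1

include p in
/-- Otherwise all components into `F' k` vanish, and so does the unit of `F' k`. -/
theorem exists_σ_eq_of_target (k : Φ'.I) [Nontrivial (Φ'.F k)] : ∃ j, Φ.σ j = Φ'.σ k := by
  by_contra! hne
  have a : PosReal := ⟨1, one_pos⟩
  have h1 := hasSum_component_unit p a k
  simp only [component_eq_zero p (hne _), zero_apply] at h1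
  exact (Φ'.frob k).toFrobenius.unit_ne_zero
    ((smul_eq_zero.1 (h1.unique hasSum_zero)).resolve_left (decay_ne_zero _ _))

/-- If every summand of the target but the `k`-th has a different `σ`, then the morphism maps the
`j`-th summand into the `k`-th. -/
theorem map_incl_eq_component (hσ : Function.Injective Φ'.σ) {j : Φ.I} {k : Φ'.I}
    (h : Φ.σ j = Φ'.σ k) (x : Φ.F j) :
    p.hom.map (Φ.incl j x) = Φ'.incl k (component p j k x) :=
  Φ'.isHilbertSum_incl.eq_of_component_eq fun l => by
    obtain rfl | hl := eq_or_ne l k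
    · rw [adjoint_apply_self]
      rfl
    · rw [Φ'.orthogonalFamily_incl.adjoint_apply_of_ne hl]
      exact DFunLike.congr_fun (component_eq_zero p fun h' => hl (hσ (h'.symm.trans h))) x

theorem isFrobeniusHom_component (hσ : Function.Injective Φ.σ) (hσ' : Function.Injective Φ'.σ)
    {j : Φ.I} {k : Φ'.I} (h : Φ.σ j = Φ'.σ k) :
    IsFrobeniusHom (Φ.frob j).toFrobenius (Φ'.frob k).toFrobenius (component p j k) := by
  have a : PosReal := ⟨1, one_pos⟩
  have hp := map_incl_eq_component p hσ' h
  have hd := decay_ne_zero (Φ'.σ k) a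
  refine ⟨ext_tmul fun x y => ?_, ContinuousLinearMap.ext_ring ?_, ?_, ?_⟩
  · have h1 := DFunLike.congr_fun (p.hom.map_mul a) (tmul (Φ.incl j x) (Φ.incl j y))
    rw [ContinuousLinearMap.comp_apply, ContinuousLinearMap.comp_apply, tmap_tmul, directSum_mul,
      hp, hp, hp, directSum_mul, map_smul (component p j k), h] at h1
    rw [ContinuousLinearMap.comp_apply, ContinuousLinearMap.comp_apply, tmap_tmul]
    exact smul_right_injective _ hd ((Φ'.incl k).injective h1)
  · have h1 := hasSum_component_unit p a k
    have h2 := hasSum_single (f := fun i => component p i k (decay (Φ.σ i) a • (Φ.frob i).η 1)) j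
      fun i hi => by rw [component_eq_zero p fun h' => hi (hσ (h'.trans h.symm)), zero_apply]
    have h3 := h2.unique h1
    rw [map_smul, h] at h3
    exact smul_right_injective _ hd h3
  · ext x
    have h1 := DFunLike.congr_fun (p.hom.map_comul a) (Φ.incl j x)
    rw [ContinuousLinearMap.comp_apply, ContinuousLinearMap.comp_apply, directSum_comul,
      hp, directSum_comul, ← ContinuousLinearMap.comp_apply, ← tmap_comp] at h1
    have h2 : p.hom.map ∘L (Φ.incl j).toContinuousLinearMap =
      (Φ'.incl k).toContinuousLinearMap ∘L component p j k := ContinuousLinearMap.ext hp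
    rw [h2, tmap_comp, ContinuousLinearMap.comp_apply, map_smul (tmap _ _), h] at h1
    exact smul_right_injective _ hd ((tmapIsometry (Φ'.incl k) (Φ'.incl k)).injective h1)
  · ext x
    have h1 := DFunLike.congr_fun (p.hom.map_counit a) (Φ.incl j x)
    rw [ContinuousLinearMap.comp_apply, hp, directSum_counit, directSum_counit, h] at h1
    exact smul_right_injective _ hd h1

theorem norm_component_le (hσ' : Function.Injective Φ'.σ) {j : Φ.I} {k : Φ'.I}
    (h : Φ.σ j = Φ'.σ k) : ‖component p j k‖ ≤ ‖p.hom.map‖ :=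
  ContinuousLinearMap.opNorm_le_bound _ (norm_nonneg _) fun x => by
    rw [← (Φ'.incl k).norm_map, ← map_incl_eq_component p hσ' h x, ← (Φ.incl j).norm_map x]
    exact p.hom.map.le_opNorm _

/-- Between reduced families, every morphism of the direct sums comes from a morphism of
families. -/
theorem exists_directSumMap_eq (hΦ : IsReduced Φ) (hΦ' : IsReduced Φ') :
    ∃ Ψ : Φ ⟶ Φ', directSumMap Ψ = p := by
  have := hΦ.1
  have := hΦ'.1
  choose f hf using fun j => exists_σ_eq_of_source p j
  have hbij : Function.Bijective f := by
    refine ⟨fun i j hij => hΦ.2 ?_, fun k => ?_⟩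
    · rw [hf, hf, hij]
    · obtain ⟨j, hj⟩ := exists_σ_eq_of_target p k
      exact ⟨j, hΦ'.2 ((hf j).symm.trans hj)⟩
  refine ⟨⟨Equiv.ofBijective f hbij, fun j => component p j (f j), hf,
    fun j => isFrobeniusHom_component p hΦ.2 hΦ'.2 (hf j),
    ‖p.hom.map‖, fun j => norm_component_le p hΦ'.2 (hf j)⟩, hom_ext_incl fun j x => ?_⟩
  exact (sumMap_incl _ j x).trans (map_incl_eq_component p hΦ'.2 (hf j) x).symm

theorem directSumMap_injective (hΦ' : IsReduced Φ') :
    Function.Injective (directSumMap : (Φ ⟶ Φ') → (Φ.directSum ⟶ Φ'.directSum)) := by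
  intro Ψ Ψ' h
  have hf : Ψ.f = Ψ'.f := Equiv.ext fun j => hΦ'.2 ((Ψ.σ_eq j).symm.trans (Ψ'.σ_eq j))
  have hψ : ∀ j x, Φ'.incl (Ψ.f j) (Ψ.ψ j x) = Φ'.incl (Ψ'.f j) (Ψ'.ψ j x) := fun j x => by
    rw [← sumMap_incl, ← sumMap_incl]
    exact congrArg (fun q : Φ.directSum ⟶ Φ'.directSum => q.hom.map (Φ.incl j x)) h
  obtain ⟨f, ψ, _, _, _⟩ := Ψ
  obtain ⟨f', ψ', _, _, _⟩ := Ψ'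
  obtain rfl : f = f' := hf
  obtain rfl : ψ = ψ' := funext fun j => ContinuousLinearMap.ext fun x =>
    (Φ'.incl (f j)).injective (hψ j x)
  rfl

end FrobFamily

/-! ### Uniqueness of direct sums -/

section Uniqueness

variable {I : Type} {B : I → RFA.{u}} {A A' : DaggerRFA.{u}}
  {ι : ∀ j, (B j).space →ₗᵢ[ℂ] A.obj.space} {ι' : ∀ j, (B j).space →ₗᵢ[ℂ] A'.obj.space}

/-- The comparison morphism between two Hilbert direct sums of the same RFAs. -/
def directSumComparison (h : IsHilbertDirectSum B A.obj ι) (h' : IsHilbertDirectSum B A'.obj ι') :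
    A ⟶ A' :=
  ⟨RFAHom.ofIsHilbertDirectSum h h' (Equiv.refl I) (fun j => 𝟙 (B j))
    (orthoSum h.isHilbertSum.OrthogonalFamily h'.isHilbertSum.OrthogonalFamily
      (fun j => .id ℂ (B j).space) 1 fun _ => ContinuousLinearMap.norm_id_le)
    fun j x => orthoSum_apply h.isHilbertSum.OrthogonalFamily h'.isHilbertSum.OrthogonalFamily
      (fun j => .id ℂ (B j).space) 1 (fun _ => ContinuousLinearMap.norm_id_le) j x⟩

theorem directSumComparison_apply (h : IsHilbertDirectSum B A.obj ι)
    (h' : IsHilbertDirectSum B A'.obj ι') (j : I) (x : (B j).space) :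
    (directSumComparison h h').hom.map (ι j x) = ι' j x :=
  orthoSum_apply h.isHilbertSum.OrthogonalFamily h'.isHilbertSum.OrthogonalFamily
    (fun j => .id ℂ (B j).space) 1 (fun _ => ContinuousLinearMap.norm_id_le) j x

theorem directSumComparison_comp (h : IsHilbertDirectSum B A.obj ι)
    (h' : IsHilbertDirectSum B A'.obj ι') :
    directSumComparison h h' ≫ directSumComparison h' h = 𝟙 A := by
  refine ObjectProperty.hom_ext _ (RFAHom.ext ((isTotal_of_isHilbertSum h.isHilbertSum).ext
    fun j => ?_))
  ext x
  change (directSumComparison h' h).hom.map ((directSumComparison h h').hom.map (ι j x)) = ι j x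
  rw [directSumComparison_apply, directSumComparison_apply]

/-- A Hilbert direct sum is determined up to isomorphism of RFAs by its summands. -/
def directSumIso (h : IsHilbertDirectSum B A.obj ι) (h' : IsHilbertDirectSum B A'.obj ι') :
    A ≅ A' where
  hom := directSumComparison h h'
  inv := directSumComparison h' h
  hom_inv_id := directSumComparison_comp h h'
  inv_hom_id := directSumComparison_comp h' h

end Uniqueness

/-! ### The semigroup of an RFA -/

instance : atZero.NeBot := by
  have : (0 : ℝ) ∈ closure {a : ℝ | 0 < a} := by
    rw [show {a : ℝ | 0 < a} = Set.Ioi 0 from rfl, closure_Ioi]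
    simp
  exact mem_closure_iff_comap_neBot.1 this

theorem continuous_extendZero {A : HilbSp.{u}} {P : PosReal → A →L[ℂ] A}
    (hP : IsContinuousFamily P) (x : A) : Continuous fun t : ℝ≥0 => extendZero P t x :=
  (hP.jointly_continuous 0 x).comp (continuous_pi fun _ => continuous_id)

theorem tendsto_apply_add {A : HilbSp.{u}} {P : PosReal → A →L[ℂ] A}
    (hP : IsContinuousFamily P) (c : PosReal) (x : A) :
    Tendsto (fun b : PosReal => P (c + b) x) atZero (𝓝 (P c x)) := by
  have h1 : Tendsto (fun b => PosReal.toNNReal c + PosReal.toNNReal b) atZero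
      (𝓝 (PosReal.toNNReal c + 0)) := tendsto_const_nhds.add tendsto_atZero_coe
  have h2 := ((continuous_extendZero hP x).tendsto _).comp h1
  rw [add_zero, extendZero_coe] at h2
  refine h2.congr fun b => ?_
  exact DFunLike.congr_fun (extendZero_coe P (c + b)) x

theorem tendsto_tmap_id {A : HilbSp.{u}} {P : PosReal → A →L[ℂ] A}
    (hP : IsContinuousFamily P) (z : HTensor A A) :
    Tendsto (fun b : PosReal => tmap (.id ℂ A) (P b) z) atZero (𝓝 z) := by
  have h1 : Continuous fun t : ℝ≥0 => tmap (extendZero P 0) (extendZero P t) z :=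
    (hP.jointly_continuous 1 z).comp (f := fun t : ℝ≥0 => ![0, t]) (by fun_prop)
  have h2 := (h1.tendsto 0).comp tendsto_atZero_coe
  rw [extendZero_zero, tmap_id] at h2
  refine h2.congr fun b => ?_
  change tmap (.id ℂ A) (extendZero P (PosReal.toNNReal b)) z = _
  rw [extendZero_coe]

/-- Two parameters have a common positive summand. -/
theorem exists_add_eq_pair (b b' : PosReal) : ∃ e d d' : PosReal, b = d + e ∧ b' = d' + e := by
  have h : 0 < min b.1 b'.1 := lt_min b.2 b'.2
  refine ⟨⟨min b.1 b'.1 / 2, by positivity⟩, ⟨b.1 - min b.1 b'.1 / 2, ?_⟩,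
    ⟨b'.1 - min b.1 b'.1 / 2, ?_⟩, Subtype.ext ?_, Subtype.ext ?_⟩
  · linarith [min_le_left b.1 b'.1]
  · linarith [min_le_right b.1 b'.1]
  · exact (sub_add_cancel _ _).symm
  · exact (sub_add_cancel _ _).symm

theorem coe_half_iterate (a : PosReal) (n : ℕ) :
    ((half^[n] a : PosReal) : ℝ) = a.1 * (1 / 2) ^ n := by
  induction n with
  | zero => simp
  | succ n ih =>
    rw [Function.iterate_succ_apply', pow_succ, ← mul_assoc, ← ih]
    simp [half, div_eq_mul_inv]

namespace RFA

variable (A : RFA.{u})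

/-- The operators `P a = μ a₁ ∘ (id ⊗ η a₂)`, `a₁ + a₂ = a`, of an RFA. -/
def P (a : PosReal) : A.space →L[ℂ] A.space :=
  A.str.μ (half a) ∘L tmap (.id ℂ A.space) (A.str.η (half a)) ∘L runitInv

theorem isContinuousFamily_P : IsContinuousFamily A.P := A.str.continuous_family

theorem tendsto_P (x : A.space) : Tendsto (fun b => A.P b x) atZero (𝓝 x) :=
  A.isContinuousFamily_P.tendsto_id x

theorem mul_unit_apply (a b : PosReal) (x : A.space) :
    A.str.μ a (tmul x (A.str.η b 1)) = A.P (a + b) x := by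
  have h := half_add_half (a + b)
  have h1 := DFunLike.congr_fun (A.str.unit a b (half (a + b)) (half (a + b)) h.symm) x
  have h2 := DFunLike.congr_fun (A.str.unit _ _ (half (a + b)) (half (a + b)) rfl) x
  have h3 := h1.trans h2.symm
  simp only [ContinuousLinearMap.comp_apply, runitInv_apply, tmap_tmul] at h3
  simpa [P, runitInv_apply, tmap_tmul] using h3

theorem unit_mul_apply (a b : PosReal) (x : A.space) :
    A.str.μ a (tmul (A.str.η b 1) x) = A.P (a + b) x := by
  have h1 := DFunLike.congr_fun (A.str.unit a b a b rfl) x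
  simp only [ContinuousLinearMap.comp_apply, runitInv_apply, lunitInv_apply, tmap_tmul] at h1
  rw [← mul_unit_apply]
  simpa using h1.symm

theorem mul_mul_apply {a₁ a₂ b₁ b₂ : PosReal} (h : a₁ + a₂ = b₁ + b₂) (x y z : A.space) :
    A.str.μ a₁ (tmul x (A.str.μ a₂ (tmul y z))) = A.str.μ b₁ (tmul (A.str.μ b₂ (tmul x y)) z) := by
  simpa [tmap_tmul, assoc_tmul] using
    DFunLike.congr_fun (A.str.mul_assoc a₁ a₂ b₁ b₂ h) (tmul (tmul x y) z)

/-- If `P b (X a)` depends only on `a + b`, then it equals `X (a + b)`, by continuity of `P`. -/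
theorem P_apply_eq_of_forall {X : PosReal → A.space}
    (h : ∀ a b a' b', a + b = a' + b' → A.P b (X a) = A.P b' (X a')) (a b : PosReal) :
    A.P b (X a) = X (a + b) := by
  have key : ∀ c, A.P (half c) (X (half c)) = X c := fun c => by
    refine tendsto_nhds_unique (tendsto_apply_add A.isContinuousFamily_P _ _)
      ((A.tendsto_P (X c)).congr fun b => h _ _ _ _ ?_)
    rw [← add_assoc, half_add_half]
  rw [← key (a + b)]
  exact h _ _ _ _ (half_add_half _).symm

theorem P_unit (a b : PosReal) : A.P b (A.str.η a 1) = A.str.η (a + b) 1 := by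
  refine A.P_apply_eq_of_forall (X := fun a => A.str.η a 1) (fun a b a' b' h => ?_) a b
  obtain ⟨e, d, d', rfl, rfl⟩ := exists_add_eq_pair b b'
  rw [← mul_unit_apply, ← mul_unit_apply, unit_mul_apply, unit_mul_apply]
  rw [← add_assoc, ← add_assoc] at h
  rw [add_comm d, add_comm d', add_right_cancel h]

theorem P_mul_tmul (a b : PosReal) (x y : A.space) :
    A.P b (A.str.μ a (tmul x y)) = A.str.μ (a + b) (tmul x y) := by
  refine A.P_apply_eq_of_forall (X := fun a => A.str.μ a (tmul x y)) (fun a b a' b' h => ?_) a b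
  obtain ⟨e, d, d', rfl, rfl⟩ := exists_add_eq_pair b b'
  rw [← add_assoc, ← add_assoc] at h
  have h' := add_right_cancel h
  rw [← mul_unit_apply, ← mul_unit_apply,
    ← A.mul_mul_apply ((half_add_half (a + d)).trans (add_comm a d)),
    ← A.mul_mul_apply ((half_add_half (a + d)).trans (h'.trans (add_comm a' d')))]

theorem P_comp_mul (a b : PosReal) : A.P b ∘L A.str.μ a = A.str.μ (a + b) :=
  ext_tmul fun x y => A.P_mul_tmul a b x y

theorem P_P (a b : PosReal) (x : A.space) : A.P b (A.P a x) = A.P (a + b) x := by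
  conv_lhs => rw [← half_add_half a, ← mul_unit_apply, P_mul_tmul, mul_unit_apply]
  rw [add_right_comm, half_add_half]

theorem mul_P_right (a b : PosReal) (x y : A.space) :
    A.str.μ a (tmul x (A.P b y)) = A.str.μ (a + b) (tmul x y) := by
  conv_lhs => rw [← half_add_half b, ← mul_unit_apply, A.mul_mul_apply rfl, mul_unit_apply,
    P_mul_tmul, add_comm, add_assoc, half_add_half]

theorem mul_P_left (a b : PosReal) (x y : A.space) :
    A.str.μ a (tmul (A.P b x) y) = A.str.μ (a + b) (tmul x y) := by
  conv_lhs => rw [← half_add_half b, ← unit_mul_apply, ← A.mul_mul_apply rfl, unit_mul_apply,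
    P_mul_tmul, add_comm, add_assoc, half_add_half]

/-- The Frobenius relation applied to the unit. -/
theorem tmap_P_comul (a c d : PosReal) (x : A.space) :
    tmap (.id ℂ A.space) (A.P a) (A.str.Δ (c + d) x) = A.str.Δ c (A.P (d + a) x) := by
  have h1 : half a + (c + d) = c + (d + half a) := by rw [add_comm, add_assoc]
  have h2 := DFunLike.congr_fun (A.str.frobenius_left (half a) (c + d) c (d + half a) h1)
    (tmul x (A.str.η (half a) 1))
  simp only [ContinuousLinearMap.comp_apply, tmap_tmul, mul_unit_apply,
    ContinuousLinearMap.id_apply] at h2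
  rw [add_assoc, half_add_half] at h2
  rw [← h2]
  have h3 : tmap (.id ℂ A.space) (A.P a) = tmap (.id ℂ A.space) (A.str.μ (half a)) ∘L assoc ∘L
      UniformSpace.Completion.toComplL ∘L
        (TensorProduct.mkL ℂ (HTensor A.space A.space) A.space).flip (A.str.η (half a) 1) := by
    refine ext_tmul fun u v => ?_
    change _ = tmap (.id ℂ A.space) (A.str.μ (half a))
      (assoc (tmul (tmul u v) (A.str.η (half a) 1)))
    rw [assoc_tmul, tmap_tmul, tmap_tmul, mul_unit_apply, half_add_half]
  rw [h3]
  rfl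

theorem comul_P (c d : PosReal) (x : A.space) : A.str.Δ c (A.P d x) = A.str.Δ (c + d) x := by
  refine tendsto_nhds_unique (((A.str.Δ c).continuous.tendsto _).comp
    (tendsto_apply_add A.isContinuousFamily_P d x)) ?_
  refine (tendsto_tmap_id A.isContinuousFamily_P (A.str.Δ (c + d) x)).congr fun a => ?_
  exact A.tmap_P_comul a c d x

end RFA

/-! ### Self-adjointness, positivity and compactness of the semigroup -/

namespace IsHermitian

variable {A : RFA.{u}} (hA : IsHermitian A)
include hA

theorem adjoint_mul (a : PosReal) : adjoint (A.str.μ a) = A.str.Δ a := (hA a).1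

theorem adjoint_unit (a : PosReal) : adjoint (A.str.η a) = A.str.ε a := (hA a).2

theorem adjoint_P (a : PosReal) : adjoint (A.P a) =
    runit ∘L tmap (.id ℂ A.space) (A.str.ε (half a)) ∘L A.str.Δ (half a) := by
  rw [RFA.P, ContinuousLinearMap.adjoint_comp, ContinuousLinearMap.adjoint_comp, adjoint_runitInv,
    adjoint_tmap, hA.adjoint_mul, hA.adjoint_unit, ContinuousLinearMap.adjoint_id]
  rfl

/-- The operators `P d` of a Hermitian RFA are self-adjoint, i.e. `P' = P`. -/
theorem adjoint_P_eq (d : PosReal) : adjoint (A.P d) = A.P d := by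
  -- `Δ c` does not distinguish `P d` from its adjoint, and `Δ c` is cancelled by the counit
  have h1 : ∀ c x, A.str.Δ c (adjoint (A.P d) x) = A.str.Δ c (A.P d x) := fun c x => by
    rw [A.comul_P, ← hA.adjoint_mul, ← hA.adjoint_mul, ← ContinuousLinearMap.comp_apply,
      ← ContinuousLinearMap.adjoint_comp, A.P_comp_mul]
  have h2 : ∀ c x, adjoint (A.P c) (adjoint (A.P d) x) = adjoint (A.P c) (A.P d x) := fun c x => by
    rw [hA.adjoint_P c, ContinuousLinearMap.comp_apply, ContinuousLinearMap.comp_apply, h1]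
    rfl
  have h3 : ∀ y, Tendsto (fun c => adjoint (A.P c) y) atZero (𝓝 y) := fun y => by
    simp only [hA.adjoint_P]
    exact A.str.cocontinuous_family.tendsto_id y
  ext x
  exact tendsto_nhds_unique (h3 _) ((h3 _).congr fun c => (h2 c x).symm)

theorem inner_P_left (a : PosReal) (x y : A.space) :
    inner ℂ (A.P a x) y = inner ℂ x (A.P a y) := by
  rw [← ContinuousLinearMap.adjoint_inner_right, hA.adjoint_P_eq]

/-- The operators `P a` are positive, as squares of self-adjoint operators. -/
theorem inner_P_self (a : PosReal) (x : A.space) :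
    inner ℂ x (A.P a x) = ((‖A.P (half a) x‖ ^ 2 : ℝ) : ℂ) := by
  rw [← half_add_half a, ← A.P_P, ← hA.inner_P_left, inner_self_eq_norm_sq_to_K, half_add_half]
  simp

/-- The operators `P a` are injective: a vector of the kernel is in the kernel of every
`P (a / 2 ^ n)` by positivity, and these converge strongly to the identity. -/
theorem P_eq_zero {a : PosReal} {x : A.space} (h : A.P a x = 0) : x = 0 := by
  have h1 : ∀ n, A.P (half^[n] a) x = 0 := fun n => by
    induction n with
    | zero => exact h
    | succ n ih =>
      rw [Function.iterate_succ_apply']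
      have := hA.inner_P_self (half^[n] a) x
      rw [ih, inner_zero_right] at this
      simpa using this.symm
  have h2 : Tendsto (fun n => half^[n] a) Filter.atTop atZero := by
    rw [Filter.tendsto_comap_iff]
    have h4 := (tendsto_pow_atTop_nhds_zero_of_lt_one (r := (1 / 2 : ℝ)) (by norm_num)
      (by norm_num)).const_mul a.1
    rw [mul_zero] at h4
    exact h4.congr fun n => (coe_half_iterate a n).symm
  refine tendsto_nhds_unique ((A.tendsto_P x).comp h2) ?_
  exact tendsto_const_nhds.congr fun n => (h1 n).symm

/-- The operator `P a` is obtained from a vector of `A ⊗ A` by contracting one tensor factor with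
a bounded bilinear form, so it is a norm limit of operators of finite rank. -/
theorem isCompactOperator_P (a : PosReal) : IsCompactOperator (A.P a) := by
  set q := half (half a) with hq
  set β : HTensor A.space A.space →L[ℂ] ℂ := A.str.ε q ∘L A.str.μ q
  let K : HTensor A.space A.space →L[ℂ] (A.space →L[ℂ] A.space) :=
    ContinuousLinearMap.compL ℂ A.space _ A.space
      (runit ∘L tmap (.id ℂ A.space) β ∘L assoc ∘L UniformSpace.Completion.toComplL) ∘L
    TensorProduct.mkL ℂ (HTensor A.space A.space) A.space
  have hK : ∀ z x, K z x = runit (tmap (.id ℂ A.space) β (assoc (tmul z x))) := fun z x => rfl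
  have hcompact : ∀ z, IsCompactOperator (K z) := by
    refine tmul_mem_of_forall
      (S := (compactOperator (RingHom.id ℂ) A.space A.space).comap
        K.toLinearMap) ?_ fun u v => ?_
    · exact isClosed_setOfPred_isCompactOperator.preimage K.continuous
    · have h1 : K (tmul u v) = ContinuousLinearMap.toSpanSingleton ℂ u ∘L β ∘L
          UniformSpace.Completion.toComplL ∘L TensorProduct.mkL ℂ A.space A.space v := by
        ext x
        rw [hK, assoc_tmul, tmap_tmul, runit_tmul]
        rfl
      change IsCompactOperator (K (tmul u v))
      rw [h1]
      exact (isCompactOperator_of_locallyCompactSpace_rng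
        (ContinuousLinearMap.toSpanSingleton ℂ u)).comp_clm (β ∘L
          UniformSpace.Completion.toComplL ∘L TensorProduct.mkL ℂ A.space A.space v)
  have hP : A.P a = K (A.str.Δ q (A.str.η q 1)) := by
    ext x
    have h1 := DFunLike.congr_fun (A.str.frobenius_left q q q q rfl) (tmul (A.str.η q 1) x)
    simp only [ContinuousLinearMap.comp_apply, tmap_tmul, A.unit_mul_apply,
      ContinuousLinearMap.id_apply] at h1
    have h2 := DFunLike.congr_fun (tmap_comp (.id ℂ A.space) (.id ℂ A.space) (A.str.ε q)
      (A.str.μ q)) (assoc (tmul (A.str.Δ q (A.str.η q 1)) x))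
    have h3 := DFunLike.congr_fun (hA.adjoint_P (half a)) (A.P (half a) x)
    rw [hA.adjoint_P_eq, A.P_P, half_add_half, ← hq] at h3
    rw [show q + q = half a from half_add_half _] at h1
    rw [hK, h3]
    exact congrArg runit
      ((congrArg (tmap (.id ℂ A.space) (A.str.ε q)) h1).symm.trans h2.symm)
  rw [hP]
  exact hcompact _

end IsHermitian

/-! ### The eigenspaces of the semigroup -/

/-- The parameter `a = 1`. -/
def unitTime : PosReal := ⟨1, one_pos⟩

theorem conj_decay (σ : ℝ) (a : PosReal) : (starRingEnd ℂ) (decay σ a) = decay σ a :=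
  Complex.conj_ofReal _

namespace RFA

variable (A : RFA.{u})

theorem extendZero_P_add (s t : ℝ≥0) (x : A.space) :
    extendZero A.P s (extendZero A.P t x) = extendZero A.P (s + t) x := by
  obtain rfl | hs := eq_or_ne s 0
  · rw [extendZero_zero, zero_add]
    rfl
  obtain rfl | ht := eq_or_ne t 0
  · rw [extendZero_zero, add_zero]
    rfl
  have hs' : 0 < (s : ℝ) := NNReal.coe_pos.2 (pos_iff_ne_zero.2 hs)
  have ht' : 0 < (t : ℝ) := NNReal.coe_pos.2 (pos_iff_ne_zero.2 ht)
  have h := A.P_P ⟨t, ht'⟩ ⟨s, hs'⟩ x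
  rw [← extendZero_coe A.P ⟨t, ht'⟩, ← extendZero_coe A.P ⟨s, hs'⟩, ← extendZero_coe A.P, add_comm]
    at h
  exact h

/-- The closed subspace on which `P a` acts by the scalar `e ^ (-a σ)` for all `a`. -/
def expSpace (σ : ℝ) : Submodule ℂ A.space where
  carrier := {x | ∀ a, A.P a x = decay σ a • x}
  add_mem' hx hy a := by rw [map_add, hx a, hy a, smul_add]
  zero_mem' a := by simp
  smul_mem' c x hx a := by rw [map_smul, hx a, smul_comm]

theorem isClosed_expSpace (σ : ℝ) : IsClosed (A.expSpace σ : Set A.space) := by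
  have : (A.expSpace σ : Set A.space) = ⋂ a, {x | A.P a x = decay σ a • x} := by
    ext x
    simp [expSpace]
  rw [this]
  exact isClosed_iInter fun a => isClosed_eq (A.P a).continuous (by fun_prop)

instance (σ : ℝ) : CompleteSpace (A.expSpace σ) := (A.isClosed_expSpace σ).completeSpace_coe

variable {A} {σ τ : ℝ} {x y : A.space}

theorem mul_scale (hx : x ∈ A.expSpace σ) (a b : PosReal) :
    A.str.μ (a + b) (tmul x y) = decay σ b • A.str.μ a (tmul x y) := by
  rw [← mul_P_left, hx b, tmul_smul_left, map_smul]

theorem mul_scale' (hy : y ∈ A.expSpace τ) (a b : PosReal) :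
    A.str.μ (a + b) (tmul x y) = decay τ b • A.str.μ a (tmul x y) := by
  rw [← mul_P_right, hy b, tmul_smul_right, map_smul]

theorem mul_mem_expSpace (hx : x ∈ A.expSpace σ) (a : PosReal) :
    A.str.μ a (tmul x y) ∈ A.expSpace σ := fun b => by
  rw [P_mul_tmul, mul_scale hx]

/-- Moving `P a` from one factor to the other scales the product by `e ^ (-a σ)` and by
`e ^ (-a τ)`. -/
theorem mul_eq_zero_of_ne (hx : x ∈ A.expSpace σ) (hy : y ∈ A.expSpace τ) (h : σ ≠ τ)
    (a : PosReal) : A.str.μ a (tmul x y) = 0 := by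
  by_contra hne
  have := (mul_scale hx a a).symm.trans (mul_scale' hy a a)
  exact h (decay_injective a (smul_left_injective ℂ hne this))

end RFA

namespace IsHermitian

variable {A : RFA.{u}} (hA : IsHermitian A) {σ τ : ℝ}
include hA

/-- On an eigenvector of the positive operator `P a` its square root `P (a / 2)` acts by the
square root of the eigenvalue. -/
theorem P_half_apply {a : PosReal} {x : A.space} (h : A.P a x = decay σ a • x) :
    A.P (half a) x = decay σ (half a) • x := by
  set s := decay σ (half a) with hs
  set w := A.P (half a) x - s • x with hw
  have h1 : A.P (half a) w = -(s • w) := by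
    rw [hw, map_sub, map_smul, A.P_P, half_add_half, h, ← half_add_half a, ← decay_mul,
      half_add_half, ← hs, smul_sub, smul_smul]
    abel
  have h2 := hA.inner_P_self (half a) w
  rw [h1, inner_neg_right, inner_smul_right, inner_self_eq_norm_sq_to_K, hs, decay] at h2
  have h3 : -(Real.exp (-(half a * σ)) * ‖w‖ ^ 2) = ‖A.P (half (half a)) w‖ ^ 2 := by
    apply Complex.ofReal_injective
    rw [Complex.ofReal_neg, Complex.ofReal_mul, Complex.ofReal_pow]
    exact h2
  have h4 := Real.exp_pos (-(half a * σ))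
  have h5 : ‖w‖ ^ 2 ≤ 0 := by
    by_contra! h6
    have := mul_pos h4 h6
    nlinarith [sq_nonneg ‖A.P (half (half a)) w‖]
  have h6 : w = 0 := by
    rw [← norm_eq_zero]
    exact pow_eq_zero_iff two_ne_zero |>.1 (le_antisymm h5 (sq_nonneg _))
  exact sub_eq_zero.1 h6

/-- The eigenspace of `P 1` for `e ^ (-σ)` is an eigenspace of every `P a`: this passes from `a`
to `a / 2` and to sums, hence holds for dyadic `a`, and for all `a` by continuity. -/
theorem mem_expSpace {x : A.space} (h : A.P unitTime x = decay σ unitTime • x) :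
    x ∈ A.expSpace σ := by
  let D : Set ℝ≥0 := {t | extendZero A.P t x = ((Real.exp (-((t : ℝ) * σ)) : ℝ) : ℂ) • x}
  have hD : IsClosed D := isClosed_eq (continuous_extendZero A.isContinuousFamily_P x) (by fun_prop)
  have hcoe : ∀ a : PosReal, PosReal.toNNReal a ∈ D ↔ A.P a x = decay σ a • x := fun a => by
    change extendZero A.P (PosReal.toNNReal a) x = decay σ a • x ↔ _
    rw [extendZero_coe]
  have hadd : ∀ s ∈ D, ∀ t ∈ D, s + t ∈ D := fun s hs t ht => by
    change extendZero A.P (s + t) x = _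
    rw [← A.extendZero_P_add, show extendZero A.P t x = _ from ht, map_smul,
      show extendZero A.P s x = _ from hs, smul_smul, ← Complex.ofReal_mul, ← Real.exp_add]
    congr 3
    push_cast
    ring
  have h0 : (0 : ℝ≥0) ∈ D := by
    change extendZero A.P 0 x = _
    simp [extendZero_zero]
  have hhalf : ∀ n, PosReal.toNNReal (half^[n] unitTime) ∈ D := fun n => by
    induction n with
    | zero => exact (hcoe _).2 h
    | succ n ih =>
      rw [Function.iterate_succ_apply']
      exact (hcoe _).2 (hA.P_half_apply ((hcoe _).1 ih))
  have hmul : ∀ n k : ℕ, k • PosReal.toNNReal (half^[n] unitTime) ∈ D := fun n k => by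
    induction k with
    | zero => simpa using h0
    | succ k ih =>
      rw [succ_nsmul]
      exact hadd _ ih _ (hhalf n)
  intro a
  refine (hcoe a).1 (hD.mem_of_tendsto (f := fun n : ℕ =>
    ⌊(a : ℝ) * 2 ^ n⌋₊ • PosReal.toNNReal (half^[n] unitTime)) (b := Filter.atTop) ?_
    (Filter.Eventually.of_forall fun n => hmul n _))
  refine NNReal.tendsto_coe.1 ?_
  have h1 := (tendsto_nat_floor_mul_div_atTop (R := ℝ) a.2.le).comp
    (tendsto_pow_atTop_atTop_of_one_lt (r := (2 : ℝ)) one_lt_two)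
  refine h1.congr fun n => ?_
  have h2 : ((PosReal.toNNReal (half^[n] unitTime) : ℝ≥0) : ℝ) = (1 / 2) ^ n := by
    rw [← one_mul ((1 / 2 : ℝ) ^ n)]
    exact coe_half_iterate unitTime n
  rw [NNReal.coe_nsmul, h2, Function.comp_apply, nsmul_eq_mul, one_div, inv_pow, div_eq_mul_inv]

theorem orthogonalFamily_expSpace :
    OrthogonalFamily ℂ (fun σ : ℝ => A.expSpace σ) fun σ => (A.expSpace σ).subtypeₗᵢ := by
  intro σ τ h x y
  have h1 := hA.inner_P_left unitTime x y
  rw [x.2, y.2, inner_smul_left, inner_smul_right, conj_decay] at h1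
  by_contra hne
  exact h (decay_injective unitTime (mul_right_cancel₀ hne h1))

/-- Eigenvalues of `P 1` are of the form `e ^ (-σ)`. -/
theorem eigenspace_le_iSup (c : ℂ) :
    Module.End.eigenspace (A.P unitTime : Module.End ℂ A.space) c ≤
      ⨆ σ : {σ : ℝ // A.expSpace σ ≠ ⊥}, A.expSpace σ := by
  intro x hx
  obtain rfl | hx0 := eq_or_ne x 0
  · exact zero_mem _
  rw [Module.End.mem_eigenspace_iff] at hx
  replace hx : A.P unitTime x = c • x := hx
  have h1 : A.P (half unitTime) x ≠ 0 := fun h => hx0 (hA.P_eq_zero h)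
  set r : ℝ := ‖A.P (half unitTime) x‖ ^ 2 / ‖x‖ ^ 2 with hr
  have hx' : (‖x‖ : ℂ) ≠ 0 := by simpa using hx0
  have hr0 : 0 < r := div_pos (pow_pos (norm_pos_iff.2 h1) 2) (pow_pos (norm_pos_iff.2 hx0) 2)
  have hc : c = (r : ℂ) := by
    have h2 := hA.inner_P_self unitTime x
    rw [hx, inner_smul_right, inner_self_eq_norm_sq_to_K] at h2
    rw [hr, Complex.ofReal_div, ← h2]
    push_cast
    exact (mul_div_cancel_right₀ c (pow_ne_zero 2 hx')).symm
  have hmem : x ∈ A.expSpace (-Real.log r) := by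
    refine hA.mem_expSpace ?_
    rw [hx, hc, decay, unitTime, one_mul, neg_neg, Real.exp_log hr0]
  exact Submodule.mem_iSup_of_mem (p := fun σ : {σ : ℝ // A.expSpace σ ≠ ⊥} => A.expSpace σ)
    ⟨-Real.log r, fun h => hx0 (by rwa [h, Submodule.mem_bot] at hmem)⟩ hmem

/-- The spectral theorem for the compact self-adjoint operator `P 1`. -/
theorem isHilbertSum_expSpace :
    IsHilbertSum ℂ (fun σ : {σ : ℝ // A.expSpace σ ≠ ⊥} => A.expSpace σ)
      fun σ => (A.expSpace σ).subtypeₗᵢ := by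
  refine IsHilbertSum.mkInternal (F := fun σ : {σ : ℝ // A.expSpace σ ≠ ⊥} => A.expSpace σ)
    (hA.orthogonalFamily_expSpace.comp Subtype.val_injective) ?_
  rw [top_le_iff, Submodule.topologicalClosure_eq_top_iff, eq_bot_iff]
  have hsymm : (A.P unitTime : A.space →ₗ[ℂ] A.space).IsSymmetric := hA.inner_P_left unitTime
  exact (Submodule.orthogonal_le (iSup_le hA.eigenspace_le_iSup)).trans
    (ContinuousLinearMap.orthogonalComplement_iSup_eigenspaces_eq_bot
      (hA.isCompactOperator_P unitTime) hsymm).le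

/-- The eigenvalue `e ^ (-σ)` of the compact operator `P 1` is non-zero. -/
theorem finiteDimensional_expSpace (σ : ℝ) : FiniteDimensional ℂ (A.expSpace σ) := by
  have := ContinuousLinearMap.finite_dimensional_eigenspace (hA.isCompactOperator_P unitTime)
    (decay σ unitTime) (decay_ne_zero _ _)
  refine Submodule.finiteDimensional_of_le (S₂ := Module.End.eigenspace
    (A.P unitTime).toLinearMap (decay σ unitTime)) fun x hx => ?_
  rw [Module.End.mem_eigenspace_iff]
  exact hx unitTime

end IsHermitian

/-! ### The `†`-Frobenius algebras on the eigenspaces -/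

theorem norm_eq_norm_apply_one {F : Type*} [NormedAddCommGroup F] [InnerProductSpace ℂ F]
    (f : ℂ →L[ℂ] F) : ‖f‖ = ‖f 1‖ := by
  refine le_antisymm (f.opNorm_le_bound (norm_nonneg _) fun c => ?_) ?_
  · rw [← mul_one c, ← smul_eq_mul, map_smul, norm_smul, smul_eq_mul, mul_one, mul_comm]
  · simpa using f.le_opNorm 1

theorem cancel_isometry_left {E F G : Type*} [NormedAddCommGroup E] [InnerProductSpace ℂ E]
    [NormedAddCommGroup F] [InnerProductSpace ℂ F] [NormedAddCommGroup G] [InnerProductSpace ℂ G]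
    (i : E →ₗᵢ[ℂ] F) {f g : G →L[ℂ] E}
    (h : i.toContinuousLinearMap ∘L f = i.toContinuousLinearMap ∘L g) : f = g := by
  ext x
  exact i.injective (DFunLike.congr_fun h x)

theorem _root_.IsHilbertSum.hasSum_components {I : Type*} {G : I → Type*} {A : HilbSp.{u}}
    [∀ i, NormedAddCommGroup (G i)] [∀ i, InnerProductSpace ℂ (G i)] [∀ i, CompleteSpace (G i)]
    {V : ∀ i, G i →ₗᵢ[ℂ] A} (hV : IsHilbertSum ℂ G V) (z : A) :
    HasSum (fun i => V i (adjoint (V i).toContinuousLinearMap z)) z := by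
  obtain ⟨w, rfl⟩ := hV.surjective_isometry z
  have h := hV.OrthogonalFamily.hasSum_linearIsometry w
  convert! h using 3 with i
  rw [← adjoint_linearIsometry_apply hV.OrthogonalFamily, adjoint_apply_self]

theorem _root_.OrthogonalFamily.summable_norm_component_sq {I : Type*} {G : I → Type*}
    {A : HilbSp.{u}}
    [∀ i, NormedAddCommGroup (G i)] [∀ i, InnerProductSpace ℂ (G i)] [∀ i, CompleteSpace (G i)]
    {V : ∀ i, G i →ₗᵢ[ℂ] A} (hV : OrthogonalFamily ℂ G V) (z : A) :
    Summable fun i => ‖adjoint (V i).toContinuousLinearMap z‖ ^ 2 := by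
  have h := (memℓp_gen_iff (p := 2) (by norm_num)).1
    (lp.memℓp (adjoint hV.linearIsometry.toContinuousLinearMap z))
  simpa only [adjoint_linearIsometry_apply, ENNReal.toReal_ofNat, Real.rpow_ofNat] using h

theorem inv_decay_sq_mul {σ : ℝ} : (decay σ unitTime)⁻¹ * (decay σ unitTime)⁻¹ *
    decay σ (unitTime + unitTime) = 1 := by
  rw [← decay_mul, ← mul_inv]
  exact inv_mul_cancel₀ (mul_ne_zero (decay_ne_zero _ _) (decay_ne_zero _ _))

/-- Rescaling a product `m` and a unit `n` which satisfy the unit laws up to the factor `d`, by a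
real factor `c` with `c ^ 2 * d = 1`, gives a `†`-Frobenius algebra. -/
def DaggerFrobenius.ofScaled {F : HilbSp.{u}} (c d : ℂ) (hc : (starRingEnd ℂ) c = c)
    (hcd : c * c * d = 1) (m : HTensor F F →L[ℂ] F) (n : ℂ →L[ℂ] F)
    (mul_unit : m ∘L tmap (.id ℂ F) n ∘L runitInv = d • .id ℂ F)
    (unit_mul : m ∘L tmap n (.id ℂ F) ∘L lunitInv = d • .id ℂ F)
    (mul_assoc : m ∘L tmap (.id ℂ F) m ∘L assoc = m ∘L tmap m (.id ℂ F))
    (comul_counit : runit ∘L tmap (.id ℂ F) (adjoint n) ∘L adjoint m = d • .id ℂ F)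
    (counit_comul : lunit ∘L tmap (adjoint n) (.id ℂ F) ∘L adjoint m = d • .id ℂ F)
    (comul_assoc : tmap (.id ℂ F) (adjoint m) ∘L adjoint m =
      assoc ∘L tmap (adjoint m) (.id ℂ F) ∘L adjoint m)
    (frobenius_left : tmap (.id ℂ F) m ∘L assoc ∘L tmap (adjoint m) (.id ℂ F) = adjoint m ∘L m)
    (frobenius_right :
      tmap m (.id ℂ F) ∘L assocInv ∘L tmap (.id ℂ F) (adjoint m) = adjoint m ∘L m) :
    DaggerFrobenius F where
  μ := c • m
  η := c • n
  Δ := c • adjoint m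
  ε := c • adjoint n
  mul_unit := by
    simp only [tmap_smul_right, ContinuousLinearMap.smul_comp, ContinuousLinearMap.comp_smul,
      mul_unit]
    rw [smul_smul, smul_smul, hcd, one_smul]
  unit_mul := by
    simp only [tmap_smul_left, ContinuousLinearMap.smul_comp, ContinuousLinearMap.comp_smul,
      unit_mul]
    rw [smul_smul, smul_smul, hcd, one_smul]
  mul_assoc := by
    simp only [tmap_smul_left, tmap_smul_right, ContinuousLinearMap.smul_comp,
      ContinuousLinearMap.comp_smul, mul_assoc]
  comul_counit := by
    simp only [tmap_smul_right, ContinuousLinearMap.smul_comp, ContinuousLinearMap.comp_smul,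
      comul_counit]
    rw [smul_smul, smul_smul, hcd, one_smul]
  counit_comul := by
    simp only [tmap_smul_left, ContinuousLinearMap.smul_comp, ContinuousLinearMap.comp_smul,
      counit_comul]
    rw [smul_smul, smul_smul, hcd, one_smul]
  comul_assoc := by
    simp only [tmap_smul_left, tmap_smul_right, ContinuousLinearMap.smul_comp,
      ContinuousLinearMap.comp_smul, comul_assoc]
  frobenius_left := by
    simp only [tmap_smul_left, tmap_smul_right, ContinuousLinearMap.smul_comp,
      ContinuousLinearMap.comp_smul, frobenius_left]
  frobenius_right := by
    simp only [tmap_smul_left, tmap_smul_right, ContinuousLinearMap.smul_comp,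
      ContinuousLinearMap.comp_smul, frobenius_right]
  adjoint_mul := by rw [LinearIsometryEquiv.map_smulₛₗ, hc]
  adjoint_unit := by rw [LinearIsometryEquiv.map_smulₛₗ, hc]

namespace RFA

variable (A : RFA.{u}) (σ : ℝ)

/-- The subspace `A.expSpace σ` as a Hilbert space. -/
abbrev expHilb : HilbSp.{u} := ⟨A.expSpace σ⟩

/-- The inclusion of `A.expSpace σ`. -/
abbrev expIncl : A.expHilb σ →ₗᵢ[ℂ] A.space := (A.expSpace σ).subtypeₗᵢ

/-- The restriction of the product to `A.expSpace σ`. The adjoint of the inclusion only serves to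
restrict the codomain, by `mul_comp_tmap_incl`. -/
def restrictMul (a : PosReal) : HTensor (A.expHilb σ) (A.expHilb σ) →L[ℂ] A.expHilb σ :=
  adjoint (A.expIncl σ).toContinuousLinearMap ∘L A.str.μ a ∘L
    tmap (A.expIncl σ).toContinuousLinearMap (A.expIncl σ).toContinuousLinearMap

/-- The component of the unit in `A.expSpace σ`. -/
def restrictUnit (a : PosReal) : ℂ →L[ℂ] A.expHilb σ :=
  adjoint (A.expIncl σ).toContinuousLinearMap ∘L A.str.η a

variable {A σ}

theorem incl_adjoint_apply {x : A.space} (hx : x ∈ A.expSpace σ) :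
    A.expIncl σ (adjoint (A.expIncl σ).toContinuousLinearMap x) = x := by
  have := adjoint_apply_self (A.expIncl σ) ⟨x, hx⟩
  exact congrArg (A.expIncl σ) this

theorem mul_comp_tmap_incl (a : PosReal) :
    A.str.μ a ∘L tmap (A.expIncl σ).toContinuousLinearMap (A.expIncl σ).toContinuousLinearMap =
      (A.expIncl σ).toContinuousLinearMap ∘L A.restrictMul σ a := by
  refine ext_tmul fun x y => ?_
  rw [restrictMul, ContinuousLinearMap.comp_apply, ContinuousLinearMap.comp_apply,
    ContinuousLinearMap.comp_apply, ContinuousLinearMap.comp_apply, tmap_tmul]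
  exact (incl_adjoint_apply (mul_mem_expSpace x.2 a)).symm

theorem restrictMul_add (a b : PosReal) :
    A.restrictMul σ (a + b) = decay σ b • A.restrictMul σ a := by
  refine cancel_isometry_left (A.expIncl σ) ?_
  rw [← mul_comp_tmap_incl, ContinuousLinearMap.comp_smul, ← mul_comp_tmap_incl]
  refine ext_tmul fun x y => ?_
  rw [ContinuousLinearMap.comp_apply, smul_apply, ContinuousLinearMap.comp_apply, tmap_tmul]
  exact mul_scale x.2 a b

theorem P_comp_incl (σ : ℝ) (a : PosReal) : A.P a ∘L (A.expIncl σ).toContinuousLinearMap =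
    (A.expIncl σ).toContinuousLinearMap ∘L (decay σ a • .id ℂ (A.expHilb σ)) := by
  ext x
  exact x.2 a

theorem restrict_mul_assoc (σ : ℝ) (a : PosReal) :
    A.restrictMul σ a ∘L tmap (.id ℂ (A.expHilb σ)) (A.restrictMul σ a) ∘L assoc =
      A.restrictMul σ a ∘L tmap (A.restrictMul σ a) (.id ℂ (A.expHilb σ)) :=
  cancel_isometry_left (A.expIncl σ) <| by
    rw [← intertwine_mul_right (mul_comp_tmap_incl a) (mul_comp_tmap_incl a),
      ← intertwine_mul_left (mul_comp_tmap_incl a) (mul_comp_tmap_incl a),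
      A.str.mul_assoc a a a a rfl]

theorem norm_restrictMul_apply_le (σ : ℝ) (a : PosReal) (z : HTensor (A.expHilb σ) (A.expHilb σ)) :
    ‖A.restrictMul σ a z‖ ≤ ‖A.str.μ a‖ * ‖z‖ := by
  rw [← (A.expIncl σ).norm_map, ← (tmapIsometry (A.expIncl σ) (A.expIncl σ)).norm_map z]
  have h := DFunLike.congr_fun (mul_comp_tmap_incl (A := A) (σ := σ) a) z
  exact (congrArg norm h).symm.trans_le ((A.str.μ a).le_opNorm _)

end RFA

namespace IsHermitian

variable {A : RFA.{u}} (hA : IsHermitian A) (σ : ℝ)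
include hA

theorem adjoint_incl_P (a : PosReal) (z : A.space) :
    adjoint (A.expIncl σ).toContinuousLinearMap (A.P a z) =
      decay σ a • adjoint (A.expIncl σ).toContinuousLinearMap z := by
  refine ext_inner_left ℂ fun x => ?_
  rw [ContinuousLinearMap.adjoint_inner_right, inner_smul_right,
    ContinuousLinearMap.adjoint_inner_right, ← hA.inner_P_left]
  have hx : A.P a ((A.expIncl σ).toContinuousLinearMap x) =
    decay σ a • (A.expIncl σ).toContinuousLinearMap x := x.2 a
  rw [hx, inner_smul_left, conj_decay]

theorem restrictUnit_add (a b : PosReal) :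
    A.restrictUnit σ (a + b) = decay σ b • A.restrictUnit σ a := by
  refine ContinuousLinearMap.ext_ring ?_
  rw [RFA.restrictUnit, ContinuousLinearMap.comp_apply, ← A.P_unit, hA.adjoint_incl_P]
  rfl

/-- The product commutes with the orthogonal projection onto `A.expSpace σ`. -/
theorem adjoint_incl_mul (a : PosReal) :
    adjoint (A.expIncl σ).toContinuousLinearMap ∘L A.str.μ a =
      A.restrictMul σ a ∘L tmap (adjoint (A.expIncl σ).toContinuousLinearMap)
        (adjoint (A.expIncl σ).toContinuousLinearMap) := by
  have htot := isTotal_of_isHilbertSum hA.isHilbertSum_expSpace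
  have hproj : ∀ {τ : ℝ} (x : A.space), x ∈ A.expSpace τ → τ ≠ σ →
      adjoint (A.expIncl σ).toContinuousLinearMap x = 0 := fun {τ} x hx h =>
    hA.orthogonalFamily_expSpace.adjoint_apply_of_ne h.symm ⟨x, hx⟩
  refine (htot.tmap htot).ext ?_
  rintro ⟨⟨τ, hτ⟩, ⟨ρ, hρ⟩⟩
  refine ext_tmul fun x y => ?_
  change adjoint (A.expIncl σ).toContinuousLinearMap (A.str.μ a (tmap _ _ (tmul x y))) =
    A.restrictMul σ a (tmap _ _ (tmap _ _ (tmul x y)))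
  rw [tmap_tmul, tmap_tmul]
  change adjoint (A.expIncl σ).toContinuousLinearMap (A.str.μ a (tmul x.1 y.1)) =
    A.restrictMul σ a (tmul (adjoint (A.expIncl σ).toContinuousLinearMap x.1)
      (adjoint (A.expIncl σ).toContinuousLinearMap y.1))
  obtain rfl | hτσ := eq_or_ne τ σ
  · obtain rfl | hρσ := eq_or_ne ρ τ
    · have h1 := adjoint_apply_self (A.expIncl ρ) x
      have h2 := adjoint_apply_self (A.expIncl ρ) y
      refine (congrArg (A.restrictMul ρ a) (congrArg₂ tmul h1 h2)).trans ?_ |>.symm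
      rw [RFA.restrictMul, ContinuousLinearMap.comp_apply, ContinuousLinearMap.comp_apply,
        tmap_tmul]
      rfl
    · rw [RFA.mul_eq_zero_of_ne x.2 y.2 hρσ.symm, map_zero, hproj y.1 y.2 hρσ, tmul_zero, map_zero]
  · rw [hproj x.1 x.2 hτσ, zero_tmul, map_zero,
      hproj _ (RFA.mul_mem_expSpace x.2 a) hτσ]

theorem comul_comp_incl (a : PosReal) :
    A.str.Δ a ∘L (A.expIncl σ).toContinuousLinearMap =
      tmap (A.expIncl σ).toContinuousLinearMap (A.expIncl σ).toContinuousLinearMap ∘L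
        adjoint (A.restrictMul σ a) := by
  have h := congrArg adjoint (hA.adjoint_incl_mul σ a)
  rwa [ContinuousLinearMap.adjoint_comp, ContinuousLinearMap.adjoint_comp, adjoint_tmap,
    ContinuousLinearMap.adjoint_adjoint, hA.adjoint_mul] at h

theorem counit_comp_incl (a : PosReal) :
    A.str.ε a ∘L (A.expIncl σ).toContinuousLinearMap = adjoint (A.restrictUnit σ a) := by
  rw [RFA.restrictUnit, ContinuousLinearMap.adjoint_comp, ContinuousLinearMap.adjoint_adjoint,
    hA.adjoint_unit]

theorem counit_comul (a b : PosReal) :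
    runit ∘L tmap (.id ℂ A.space) (A.str.ε b) ∘L A.str.Δ a = A.P (a + b) := by
  have h : A.str.μ a ∘L tmap (.id ℂ A.space) (A.str.η b) ∘L runitInv = A.P (a + b) := by
    ext x
    simp [runitInv_apply, tmap_tmul, A.mul_unit_apply]
  have h' := congrArg adjoint h
  rw [ContinuousLinearMap.adjoint_comp, ContinuousLinearMap.adjoint_comp, adjoint_runitInv,
    adjoint_tmap, hA.adjoint_mul, hA.adjoint_unit, ContinuousLinearMap.adjoint_id,
    hA.adjoint_P_eq] at h'
  exact h'

theorem counit_comul' (a b : PosReal) :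
    lunit ∘L tmap (A.str.ε b) (.id ℂ A.space) ∘L A.str.Δ a = A.P (a + b) := by
  rw [← A.str.counit a b a b rfl, hA.counit_comul]

/-- The counit law, up to the factor by which `P (2 a)` acts. -/
theorem restrict_comul_counit (a : PosReal) :
    runit ∘L tmap (.id ℂ (A.expHilb σ)) (adjoint (A.restrictUnit σ a)) ∘L
      adjoint (A.restrictMul σ a) = decay σ (a + a) • .id ℂ (A.expHilb σ) :=
  cancel_isometry_left (A.expIncl σ) <| by
    rw [← intertwine_counit_right (hA.comul_comp_incl σ a) (hA.counit_comp_incl σ a),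
      hA.counit_comul, RFA.P_comp_incl]

theorem restrict_counit_comul (a : PosReal) :
    lunit ∘L tmap (adjoint (A.restrictUnit σ a)) (.id ℂ (A.expHilb σ)) ∘L
      adjoint (A.restrictMul σ a) = decay σ (a + a) • .id ℂ (A.expHilb σ) :=
  cancel_isometry_left (A.expIncl σ) <| by
    rw [← intertwine_counit_left (hA.comul_comp_incl σ a) (hA.counit_comp_incl σ a),
      hA.counit_comul', RFA.P_comp_incl]

theorem restrict_mul_unit (a : PosReal) :
    A.restrictMul σ a ∘L tmap (.id ℂ (A.expHilb σ)) (A.restrictUnit σ a) ∘L runitInv =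
      decay σ (a + a) • .id ℂ (A.expHilb σ) := by
  have h := congrArg adjoint (hA.restrict_comul_counit σ a)
  rw [ContinuousLinearMap.adjoint_comp, ContinuousLinearMap.adjoint_comp, adjoint_runit,
    adjoint_tmap, ContinuousLinearMap.adjoint_adjoint, ContinuousLinearMap.adjoint_adjoint,
    LinearIsometryEquiv.map_smulₛₗ, ContinuousLinearMap.adjoint_id, conj_decay] at h
  exact h

theorem restrict_unit_mul (a : PosReal) :
    A.restrictMul σ a ∘L tmap (A.restrictUnit σ a) (.id ℂ (A.expHilb σ)) ∘L lunitInv =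
      decay σ (a + a) • .id ℂ (A.expHilb σ) := by
  have h := congrArg adjoint (hA.restrict_counit_comul σ a)
  rw [ContinuousLinearMap.adjoint_comp, ContinuousLinearMap.adjoint_comp, adjoint_lunit,
    adjoint_tmap, ContinuousLinearMap.adjoint_adjoint, ContinuousLinearMap.adjoint_adjoint,
    LinearIsometryEquiv.map_smulₛₗ, ContinuousLinearMap.adjoint_id, conj_decay] at h
  exact h

theorem restrict_comul_assoc (a : PosReal) :
    tmap (.id ℂ (A.expHilb σ)) (adjoint (A.restrictMul σ a)) ∘L adjoint (A.restrictMul σ a) =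
      assoc ∘L tmap (adjoint (A.restrictMul σ a)) (.id ℂ (A.expHilb σ)) ∘L
        adjoint (A.restrictMul σ a) :=
  cancel_isometry_left (tmapIsometry (A.expIncl σ) (tmapIsometry (A.expIncl σ) (A.expIncl σ))) <|
    (intertwine_comul_right (hA.comul_comp_incl σ a) (hA.comul_comp_incl σ a)).symm.trans <| by
      rw [A.str.comul_assoc a a a a rfl]
      exact intertwine_comul_left (hA.comul_comp_incl σ a) (hA.comul_comp_incl σ a)

theorem comul_mul_comp_incl (a : PosReal) :
    (A.str.Δ a ∘L A.str.μ a) ∘L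
        tmap (A.expIncl σ).toContinuousLinearMap (A.expIncl σ).toContinuousLinearMap =
      tmap (A.expIncl σ).toContinuousLinearMap (A.expIncl σ).toContinuousLinearMap ∘L
        adjoint (A.restrictMul σ a) ∘L A.restrictMul σ a := by
  rw [ContinuousLinearMap.comp_assoc, RFA.mul_comp_tmap_incl, ← ContinuousLinearMap.comp_assoc,
    hA.comul_comp_incl]
  rfl

theorem restrict_frobenius_left (a : PosReal) :
    tmap (.id ℂ (A.expHilb σ)) (A.restrictMul σ a) ∘L assoc ∘L
        tmap (adjoint (A.restrictMul σ a)) (.id ℂ (A.expHilb σ)) =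
      adjoint (A.restrictMul σ a) ∘L A.restrictMul σ a :=
  cancel_isometry_left (tmapIsometry (A.expIncl σ) (A.expIncl σ)) <|
    (intertwine_frobenius_left (RFA.mul_comp_tmap_incl a) (hA.comul_comp_incl σ a)).symm.trans <| by
      rw [A.str.frobenius_left a a a a rfl]
      exact hA.comul_mul_comp_incl σ a

theorem restrict_frobenius_right (a : PosReal) :
    tmap (A.restrictMul σ a) (.id ℂ (A.expHilb σ)) ∘L assocInv ∘L
        tmap (.id ℂ (A.expHilb σ)) (adjoint (A.restrictMul σ a)) =
      adjoint (A.restrictMul σ a) ∘L A.restrictMul σ a :=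
  cancel_isometry_left (tmapIsometry (A.expIncl σ) (A.expIncl σ)) <|
    (intertwine_frobenius_right (RFA.mul_comp_tmap_incl a)
      (hA.comul_comp_incl σ a)).symm.trans <| by
      rw [A.str.frobenius_right a a a a rfl]
      exact hA.comul_mul_comp_incl σ a

/-- The `†`-Frobenius algebra structure on the eigenspace `A.expSpace σ`, whose structure maps are
the restrictions of those of `A` at `a = 1`, divided by `e ^ (-σ)`. -/
def expFrobenius : DaggerFrobenius (A.expHilb σ) :=
  .ofScaled (decay σ unitTime)⁻¹ (decay σ (unitTime + unitTime))
    (by rw [map_inv₀, conj_decay]) inv_decay_sq_mul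
    (A.restrictMul σ unitTime) (A.restrictUnit σ unitTime)
    (hA.restrict_mul_unit σ unitTime) (hA.restrict_unit_mul σ unitTime)
    (RFA.restrict_mul_assoc σ unitTime)
    (hA.restrict_comul_counit σ unitTime) (hA.restrict_counit_comul σ unitTime)
    (hA.restrict_comul_assoc σ unitTime)
    (hA.restrict_frobenius_left σ unitTime) (hA.restrict_frobenius_right σ unitTime)

theorem decay_smul_mul (a : PosReal) :
    decay σ a • (hA.expFrobenius σ).μ = A.restrictMul σ a := by
  change decay σ a • (decay σ unitTime)⁻¹ • A.restrictMul σ unitTime = _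
  rw [smul_comm, ← RFA.restrictMul_add, add_comm, RFA.restrictMul_add, smul_smul,
    inv_mul_cancel₀ (decay_ne_zero _ _), one_smul]

theorem decay_smul_unit (a : PosReal) :
    decay σ a • (hA.expFrobenius σ).η = A.restrictUnit σ a := by
  change decay σ a • (decay σ unitTime)⁻¹ • A.restrictUnit σ unitTime = _
  rw [smul_comm, ← hA.restrictUnit_add, add_comm, hA.restrictUnit_add, smul_smul,
    inv_mul_cancel₀ (decay_ne_zero _ _), one_smul]

theorem decay_smul_comul (a : PosReal) :
    decay σ a • (hA.expFrobenius σ).Δ = adjoint (A.restrictMul σ a) := by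
  rw [← hA.decay_smul_mul, LinearIsometryEquiv.map_smulₛₗ, conj_decay,
    (hA.expFrobenius σ).adjoint_mul]

theorem decay_smul_counit (a : PosReal) :
    decay σ a • (hA.expFrobenius σ).ε = adjoint (A.restrictUnit σ a) := by
  rw [← hA.decay_smul_unit, LinearIsometryEquiv.map_smulₛₗ, conj_decay,
    (hA.expFrobenius σ).adjoint_unit]

theorem restrictUnit_ne_zero (h : A.expSpace σ ≠ ⊥) : A.restrictUnit σ unitTime 1 ≠ 0 := by
  have : Nontrivial (A.expHilb σ) := Submodule.nontrivial_iff_ne_bot.2 h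
  have h1 := (hA.expFrobenius σ).toFrobenius.unit_ne_zero
  rw [← hA.decay_smul_unit]
  exact smul_ne_zero (decay_ne_zero _ _) h1

/-- Only countably many eigenspaces are non-zero, since in each of them the unit has a non-zero
component and the components of a vector are summable. -/
theorem countable_expSpace_ne_bot : Countable {σ : ℝ // A.expSpace σ ≠ ⊥} := by
  have h := (hA.isHilbertSum_expSpace.hasSum_components (A.str.η unitTime 1)).summable
  rw [← Set.countable_univ_iff]
  refine h.countable_support.mono fun σ _ => ?_
  rw [Function.mem_support]
  exact fun h0 => hA.restrictUnit_ne_zero σ.1 σ.2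
    ((A.expIncl σ.1).injective (h0.trans (map_zero _).symm))

/-- The family of the non-zero eigenspaces of a Hermitian RFA. -/
def eigenFamily : FrobFamily.{u} where
  I := {σ : ℝ // A.expSpace σ ≠ ⊥}
  countable := hA.countable_expSpace_ne_bot
  F σ := A.expHilb σ
  frob σ := hA.expFrobenius σ
  σ := Subtype.val
  bddAbove_mul a ha := by
    refine ⟨‖A.str.μ ⟨a, ha⟩‖, ?_⟩
    rintro _ ⟨σ, rfl⟩
    have h0 := Real.exp_pos (-(a * σ.1))
    have h1 : ‖(hA.expFrobenius σ.1).μ‖ ≤ (Real.exp (-(a * σ.1)))⁻¹ * ‖A.str.μ ⟨a, ha⟩‖ := by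
      refine ContinuousLinearMap.opNorm_le_bound _ (by positivity) fun z => ?_
      have h2 := RFA.norm_restrictMul_apply_le σ.1 ⟨a, ha⟩ z
      rw [← hA.decay_smul_mul, smul_apply, norm_smul, norm_decay] at h2
      rwa [mul_assoc, inv_mul_eq_div, le_div_iff₀ h0, mul_comm]
    dsimp only
    rwa [inv_mul_eq_div, le_div_iff₀ h0, mul_comm] at h1
  summable_unit a ha := by
    have h := hA.isHilbertSum_expSpace.OrthogonalFamily.summable_norm_component_sq
      (A.str.η ⟨a, ha⟩ 1)
    refine h.congr fun σ => ?_
    have h1 := congrArg (fun f => f 1) (hA.decay_smul_unit σ.1 ⟨a, ha⟩)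
    have h2 : ‖(hA.expFrobenius σ.1).η‖ = ‖(hA.expFrobenius σ.1).η 1‖ :=
      norm_eq_norm_apply_one _
    have h3 : Real.exp (-(2 * a * σ.1)) = Real.exp (-(a * σ.1)) ^ 2 := by
      rw [← Real.exp_nat_mul]
      congr 1
      push_cast
      ring
    have h4 : adjoint (A.expIncl σ.1).toContinuousLinearMap (A.str.η ⟨a, ha⟩ 1) =
      decay σ.1 ⟨a, ha⟩ • (hA.expFrobenius σ.1).η 1 := h1.symm
    rw [h2, h3, ← mul_pow]
    refine (congrArg (fun z => ‖z‖ ^ 2) h4).trans ?_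
    rw [norm_smul, norm_decay]

theorem isReduced_eigenFamily : IsReduced hA.eigenFamily :=
  ⟨fun σ => Submodule.nontrivial_iff_ne_bot.2 σ.2, Subtype.val_injective⟩

/-- A Hermitian RFA is the Hilbert direct sum of its non-zero eigenspaces. -/
theorem isHilbertDirectSum_eigenFamily :
    IsHilbertDirectSum (fun σ => (hA.eigenFamily.summand σ).obj) A fun σ => A.expIncl σ.1 where
  isHilbertSum := hA.isHilbertSum_expSpace
  mul_same := fun a σ (x y : A.expHilb σ.1) => by
    have h := DFunLike.congr_fun (RFA.mul_comp_tmap_incl (A := A) (σ := σ.1) a) (tmul x y)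
    rw [ContinuousLinearMap.comp_apply, tmap_tmul, ← hA.decay_smul_mul] at h
    exact h
  mul_ne a σ τ h x y := RFA.mul_eq_zero_of_ne x.2 y.2 (Subtype.val_injective.ne h) a
  unit a := by
    have h := hA.isHilbertSum_expSpace.hasSum_components (A.str.η a 1)
    have h' : (fun σ : {σ : ℝ // A.expSpace σ ≠ ⊥} => A.expIncl σ.1
        ((decay σ.1 a • (hA.expFrobenius σ.1).η) 1)) = fun σ => A.expIncl σ.1
          (adjoint (A.expIncl σ.1).toContinuousLinearMap (A.str.η a 1)) := by
      funext σ
      rw [hA.decay_smul_unit]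
      rfl
    exact h' ▸ h
  comul a σ x := by
    have h := DFunLike.congr_fun (hA.comul_comp_incl σ.1 a) x
    rw [← hA.decay_smul_comul] at h
    exact h
  counit a σ x := by
    have h := DFunLike.congr_fun (hA.counit_comp_incl σ.1 a) x
    rw [← hA.decay_smul_counit] at h
    exact h

end IsHermitian

/-! ### The equivalence of categories -/

instance : (IsReduced.ι ⋙ directSumFunctor.{u}).Faithful where
  map_injective {_ Φ'} _ _ h :=
    ObjectProperty.hom_ext _ (FrobFamily.directSumMap_injective Φ'.property h)

instance : (IsReduced.ι ⋙ directSumFunctor.{u}).Full where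
  map_surjective {Φ Φ'} p := by
    obtain ⟨Ψ, hΨ⟩ := FrobFamily.exists_directSumMap_eq p Φ.property Φ'.property
    exact ⟨⟨Ψ⟩, hΨ⟩

instance : (IsReduced.ι ⋙ directSumFunctor.{u}).EssSurj where
  mem_essImage A := ⟨⟨_, A.property.isReduced_eigenFamily⟩,
    ⟨directSumIso (FrobFamily.isHilbertDirectSum_directSum _)
      A.property.isHilbertDirectSum_eigenFamily⟩⟩

instance : (IsReduced.ι ⋙ directSumFunctor.{u}).IsEquivalence where

end HermRFA

end

theorem theorem2p22 :
    (∃ (G : HermRFA.FrobFamily.{u} ⥤ HermRFA.DaggerRFA.{u})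
        (ι : ∀ (Φ : HermRFA.FrobFamily.{u}) (j : Φ.I),
          (Φ.summand j).obj.space →ₗᵢ[ℂ] (G.obj Φ).obj.space),
      (∀ Φ, HermRFA.IsHilbertDirectSum (fun j => (Φ.summand j).obj) (G.obj Φ).obj (ι Φ)) ∧
      (∀ (Φ Φ' : HermRFA.FrobFamily.{u}) (Ψ : Φ ⟶ Φ') (j : Φ.I) (x : Φ.F j),
        (G.map Ψ).hom.map (ι Φ j x) = ι Φ' (Ψ.f j) (Ψ.ψ j x)) ∧
      (HermRFA.IsReduced.ι ⋙ G).IsEquivalence) ∧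
    (∀ A : HermRFA.DaggerRFA.{u}, ∃ Φ : HermRFA.FrobFamily.{u}, HermRFA.IsReduced Φ ∧
      (∀ j, FiniteDimensional ℂ (Φ.F j)) ∧
      ∃ ι : ∀ j, (Φ.summand j).obj.space →ₗᵢ[ℂ] A.obj.space,
        HermRFA.IsHilbertDirectSum (fun j => (Φ.summand j).obj) A.obj ι) := by
  exact ⟨⟨HermRFA.directSumFunctor, fun Φ => Φ.incl, fun Φ => Φ.isHilbertDirectSum_directSum,
      fun _ _ Ψ j x => HermRFA.FrobFamily.sumMap_incl Ψ j x, inferInstance⟩,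
    fun A => ⟨A.property.eigenFamily, A.property.isReduced_eigenFamily,
      fun σ => A.property.finiteDimensional_expSpace σ.1,
      fun σ => A.obj.expIncl σ.1, A.property.isHilbertDirectSum_eigenFamily⟩⟩
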